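/- For $k\in(0,1)$ let $F(\varphi,k)=\int_0^{\varphi}\frac{dt}{\sqrt{1-k^2\sin^2t}}$, $K(k)=F(\pi/2,k)$, let $\mathrm{am}(\cdot;k)$ be the inverse function of $F(\cdot,k):\mathbb R\to\mathbb R$, let $\mathrm{sn}(u;k)=\sin(\mathrm{am}(u;k))$, $\mathrm{dn}(u;k)=\sqrt{1-k^2\,\mathrm{sn}^2(u;k)}$, and let $\mathrm{dn}^{-1}(\cdot;k):[\sqrt{1-k^2},1]\to[0,K(k)]$ be the inverse of the restriction of $\mathrm{dn}(\cdot;k)$ to $[0,K(k)]$. For $Z\in\mathbb R\setminus\{0\}$, $\omega>Z^2/4$ and $0<\eta<\theta(\omega,Z):=-\frac{\sqrt2}{4}|Z|+\sqrt{\omega-\frac{Z^2}{8}}$ put $$\eta_1=\sqrt{2\omega-\eta^2},\qquad k=\sqrt{\frac{2\omega-2\eta^2}{2\omega-\eta^2}},\qquad \Phi=\left(\frac{(2\omega-\frac{Z^2}{2})+\sqrt{(2\omega-\frac{Z^2}{2})^2-4\eta^2(2\omega-\eta^2)}}{2}\right)^{1/2},\qquad a=\mathrm{dn}^{-1}\Big(\frac{\Phi}{\eta_1};k\Big),$$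 $$T(\eta,\omega,Z)=\begin{cases}\frac{2\sqrt2}{\eta_1}\,[K(k)-a],& Z>0,\\[2pt] \frac{2\sqrt2}{\eta_1}\,[K(k)+a],& Z<0.\end{cases}$$ **Theorem.** Let $L>0$ and $Z\in\mathbb R\setminus\{0\}$. There is $\Omega=\Omega(L,Z)\ge Z^2/4$ such that for every $\omega>\Omega$ there is exactly one $\eta_2=\eta_2(\omega)\in(0,\theta(\omega,Z))$ with $T(\eta_2,\omega,Z)=2L$, and such that the $2L$-periodic dnoidal-peak $$\varphi_{\omega,Z}(\xi)=\begin{cases}\eta_1\,\mathrm{dn}\big(\frac{\eta_1}{\sqrt2}|\xi|+a;k\big),& Z>0,\\[2pt] \eta_1\,\mathrm{dn}\big(\frac{\eta_1}{\sqrt2}|\xi|-a;k\big),& Z<0,\end{cases}\qquad \xi\in[-L,L],$$ with $\eta_1,k,a$ evaluated at $\eta=\eta_2(\omega)$, satisfies: the map $\omega\mapsto\|\varphi_{\omega,Z}\|^2=\int_{-L}^{L}\varphi_{\omega,Z}(\xi)^2\,d\xi$ is differentiable on $(\Omega,\infty)$ and $$\frac{d}{d\omega}\|\varphi_{\omega,Z}\|^2>0\qquad\text{for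 all }\omega>\Omega .$$ -/

import Mathlib

open Set

noncomputable section

/-- The normal elliptic integral of the first kind
`F(φ, k) = ∫₀^φ dt / √(1 - k² sin² t)`. -/
def ellipticF (k φ : ℝ) : ℝ :=
  ∫ t in (0 : ℝ)..φ, 1 / Real.sqrt (1 - k ^ 2 * Real.sin t ^ 2)

/-- The complete elliptic integral of the first kind `K(k) = F(π/2, k)`. -/
def ellipticK (k : ℝ) : ℝ := ellipticF k (Real.pi / 2)

/-- The Jacobi amplitude `am(u; k)`: the `φ` with `F(φ, k) = u`. For `0 ≤ k < 1` the map `F(·, k)`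
is a bijection of the line, so this is its inverse. -/
def jacobiAm (k u : ℝ) : ℝ := Function.invFun (ellipticF k) u

/-- The Jacobi elliptic function `sn(u; k)`. -/
def jacobiSn (k u : ℝ) : ℝ := Real.sin (jacobiAm k u)

/-- The Jacobi elliptic function `dn(u; k) = √(1 - k² sn²(u; k))`. -/
def jacobiDn (k u : ℝ) : ℝ := Real.sqrt (1 - k ^ 2 * jacobiSn k u ^ 2)

/-- The inverse of the decreasing bijection `dn(·; k) : [0, K(k)] → [√(1 - k²), 1]`
(for `0 < k < 1`). -/
def jacobiDnInv (k y : ℝ) : ℝ := Function.invFunOn (jacobiDn k) (Icc 0 (ellipticK k)) y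

/-- `θ(ω, Z)`, the upper end of the range of the parameter `η₂`. For `ω > Z² / 4` and `η₂ > 0`, the
condition `η₂ < θ(ω, Z)` means `η₁ - η₂ > |Z| / √2` with `η₁ = √(2ω - η₂²)`. -/
def peakTheta (ω Z : ℝ) : ℝ :=
  -(Real.sqrt 2 / 4) * |Z| + Real.sqrt (ω - Z ^ 2 / 8)

/-- The amplitude `η₁ = √(2ω - η₂²)`. -/
def peakEtaOne (η ω : ℝ) : ℝ := Real.sqrt (2 * ω - η ^ 2)

/-- The modulus `k(η₂, ω)`, `k² = (2ω - 2η₂²) / (2ω - η₂²)`. -/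
def peakModulus (η ω : ℝ) : ℝ := Real.sqrt ((2 * ω - 2 * η ^ 2) / (2 * ω - η ^ 2))

/-- The height `Φ(η₂, ω, Z)` of the profile at the defect. -/
def peakHeight (η ω Z : ℝ) : ℝ :=
  Real.sqrt (((2 * ω - Z ^ 2 / 2)
    + Real.sqrt ((2 * ω - Z ^ 2 / 2) ^ 2 - 4 * η ^ 2 * (2 * ω - η ^ 2))) / 2)

/-- The shift `a(η₂, ω, Z) = dn⁻¹(Φ / η₁; k)`, which lies in `[0, K(k)]`. -/
def peakShift (η ω Z : ℝ) : ℝ :=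
  jacobiDnInv (peakModulus η ω) (peakHeight η ω Z / peakEtaOne η ω)

/-- The minimal period of the peak: `T₋ = (2√2 / η₁) (K(k) - a)` for `Z > 0` and
`T₊ = (2√2 / η₁) (K(k) + a)` for `Z < 0`. -/
def peakPeriod (η ω Z : ℝ) : ℝ :=
  2 * Real.sqrt 2 / peakEtaOne η ω *
    (if 0 < Z then ellipticK (peakModulus η ω) - peakShift η ω Z
      else ellipticK (peakModulus η ω) + peakShift η ω Z)

/-- The dnoidal-peak profile with parameters `η₂ = η`, `ω`, `Z`, as a function on the period
interval `[-L, L]`: `φ(ξ) = η₁ dn(η₁ |ξ| / √2 + a; k)` for `Z > 0` and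
`ζ(ξ) = η₁ dn(η₁ |ξ| / √2 - a; k)` for `Z < 0`. -/
def peakProfile (η ω Z ξ : ℝ) : ℝ :=
  peakEtaOne η ω * jacobiDn (peakModulus η ω)
    (if 0 < Z then peakEtaOne η ω / Real.sqrt 2 * |ξ| + peakShift η ω Z
      else peakEtaOne η ω / Real.sqrt 2 * |ξ| - peakShift η ω Z)

/-- `η` is an admissible value of `η₂` for which the dnoidal peak has period `2L`. -/
def IsPeakParameter (L Z ω η : ℝ) : Prop :=
  0 < η ∧ η < peakTheta ω Z ∧ peakPeriod η ω Z = 2 * L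

/-- The squared norm `‖φ‖² = ∫_{-L}^{L} φ(ξ)² dξ` in `L²_per([-L, L])` of the dnoidal peak. -/
def peakNormSq (L Z ω η : ℝ) : ℝ := ∫ ξ in (-L)..L, peakProfile η ω Z ξ ^ 2

end

/-! Replace η₂ by the complementary modulus p = η₂/η₁ and the shift by its amplitude α, taken with
the sign of Z so that both cases of the statement become one. Put Δ = √(cos² + p² sin²) and let G =
`tailF` = ∫ 1/Δ, E = `tailE` = ∫ Δ over [α, π/2], and S = `dnSlope`. Since η₁²(1 + p²) = 2ω, the
derivative jump at the defect and the period condition become S / √(1+p²) = Z / (2√ω) and G √(1+p²)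
= L √ω, while the squared norm is (4/L) G E.

For large ω the second equation makes G large. As pG ≤ π, p is then small, and the first equation
makes α small: every admissible pair lies in `smallBox`. There the linearized system is nearly
triangular in (α, log p), because S varies in α at a rate of at least about 1/2 but in log p only at
order p², while G varies in log p at a rate of about −E. Hence the two equations determine (α, p)
(`eq_of_mem_smallBox`), which gives uniqueness. The inverse function theorem gives differentiability
(`exists_hasDerivAt_of_constraints`). Existence follows from the intermediate value theorem in η₂
(`exists_isPeakParameter`).

For the sign, differentiate both equations and multiply by 2ω. Then G changes at rate about G, while
the rate of E is at most |a| plus terms of size p²G², with a the rate of α and |a| ≤ 3|S| + 3p²G.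
Multiplying the two equations gives SG = LZ/2, and p decays fast enough in G to make p²G³ bounded.
So 2ω (GE)' is at least 0.9 (G − 1) minus a constant depending on LZ only, which is positive once G
is large (`product_deriv_pos`). -/

section ParametricIntegral

/-! ### Integrals depending on a parameter and on their lower endpoint. -/

open Filter Topology MeasureTheory

/-- The linear form `(x, y) ↦ a x + b y` on the plane. -/
def planeForm (a b : ℝ) : ℝ × ℝ →L[ℝ] ℝ :=
  a • ContinuousLinearMap.fst ℝ ℝ ℝ + b • ContinuousLinearMap.snd ℝ ℝ ℝ

@[simp] lemma planeForm_apply (a b : ℝ) (z : ℝ × ℝ) : planeForm a b z = a * z.1 + b * z.2 := by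
  simp [planeForm]

/-- Strict differentiability is what the inverse function theorem consumes later; continuity of the
partial derivatives supplies it. -/
lemma hasStrictFDerivAt_of_partials {f f₁ f₂ : ℝ × ℝ → ℝ} {U : Set (ℝ × ℝ)} (hU : IsOpen U)
    (h₁ : ∀ z ∈ U, HasDerivAt (fun x => f (x, z.2)) (f₁ z) z.1)
    (h₂ : ∀ z ∈ U, HasDerivAt (fun y => f (z.1, y)) (f₂ z) z.2)
    (c₁ : ContinuousOn f₁ U) (c₂ : ContinuousOn f₂ U) {z : ℝ × ℝ} (hz : z ∈ U) :
    HasStrictFDerivAt f (planeForm (f₁ z) (f₂ z)) z := by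
  have hn : U ∈ 𝓝 z := hU.mem_nhds hz
  have key := hasStrictFDerivAt_uncurry_coprod (𝕜 := ℝ) (u := z) (f := fun x y => f (x, y))
    (f₁ := fun x y => ContinuousLinearMap.toSpanSingleton ℝ (f₁ (x, y)))
    (f₂ := fun x y => ContinuousLinearMap.toSpanSingleton ℝ (f₂ (x, y)))
    (by filter_upwards [hn] with v hv using (h₁ v hv).hasFDerivAt)
    (by filter_upwards [hn] with v hv using (h₂ v hv).hasFDerivAt)
    (((ContinuousLinearMap.toSpanSingletonCLE (𝕜 := ℝ) (E := ℝ)).continuous.continuousAt).comp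
      (c₁.continuousAt hn))
    (((ContinuousLinearMap.toSpanSingletonCLE (𝕜 := ℝ) (E := ℝ)).continuous.continuousAt).comp
      (c₂.continuousAt hn))
  refine HasStrictFDerivAt.congr_fderiv key ?_
  ext <;> simp [planeForm, Function.HasUncurry.uncurry]

variable {g g' : ℝ → ℝ → ℝ}

lemma continuous_of_continuousOn_pos (hg : ContinuousOn (Function.uncurry g) (Ioi 0 ×ˢ univ))
    {p : ℝ} (hp : 0 < p) : Continuous (g p) := by
  have : Continuous fun t : ℝ => Function.uncurry g (p, t) :=
    hg.comp_continuous (by fun_prop) (fun t => ⟨hp, mem_univ _⟩)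
  exact this

lemma continuousOn_integral_left (hg : ContinuousOn (Function.uncurry g) (Ioi 0 ×ˢ univ)) (b : ℝ) :
    ContinuousOn (fun z : ℝ × ℝ => ∫ t in z.1..b, g z.2 t) {z | 0 < z.2} := by
  intro z hz
  have hz : 0 < z.2 := hz
  refine ContinuousAt.continuousWithinAt ?_
  -- Clamping the parameter from below keeps it positive, so the integrand becomes continuous
  -- everywhere without changing near `z`.
  have hc : Continuous (Function.uncurry fun (w : ℝ × ℝ) t => g (max w.2 (z.2 / 2)) t) := by
    have : Continuous fun w : (ℝ × ℝ) × ℝ => Function.uncurry g (max w.1.2 (z.2 / 2), w.2) :=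
      hg.comp_continuous (by fun_prop) (fun w => ⟨lt_max_of_lt_right (half_pos hz), mem_univ _⟩)
    exact this
  have h := (intervalIntegral.continuous_parametric_intervalIntegral_of_continuous
    (μ := volume) (a₀ := b) hc (s := fun w => w.1) continuous_fst).neg
  refine h.continuousAt.congr ?_
  have : {w : ℝ × ℝ | z.2 / 2 < w.2} ∈ 𝓝 z :=
    (isOpen_lt continuous_const continuous_snd).mem_nhds (half_lt_self hz)
  filter_upwards [this] with w hw
  rw [Pi.neg_apply, max_eq_left (le_of_lt hw), intervalIntegral.integral_symm, neg_neg]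

lemma hasDerivAt_integral_param (hg : ContinuousOn (Function.uncurry g) (Ioi 0 ×ˢ univ))
    (hg' : ContinuousOn (Function.uncurry g') (Ioi 0 ×ˢ univ))
    (hd : ∀ p t, 0 < p → HasDerivAt (fun q => g q t) (g' p t) p) (a b : ℝ) {p : ℝ} (hp : 0 < p) :
    HasDerivAt (fun q => ∫ t in a..b, g q t) (∫ t in a..b, g' p t) p := by
  have hK : IsCompact (Icc (p / 2) (2 * p) ×ˢ uIcc a b) := isCompact_Icc.prod isCompact_uIcc
  obtain ⟨M, hM⟩ := hK.exists_bound_of_continuousOn (f := Function.uncurry g')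
    (hg'.mono (fun x hx => ⟨lt_of_lt_of_le (by linarith) hx.1.1, mem_univ _⟩))
  refine (intervalIntegral.hasDerivAt_integral_of_dominated_loc_of_deriv_le (μ := volume)
    (F := g) (F' := g') (bound := fun _ => M) (Icc_mem_nhds (a := p / 2) (b := 2 * p)
      (by linarith) (by linarith)) ?_ ?_ ?_ ?_ ?_ ?_).2
  · filter_upwards [Ioi_mem_nhds hp] with q hq
    exact (continuous_of_continuousOn_pos hg hq).aestronglyMeasurable
  · exact (continuous_of_continuousOn_pos hg hp).intervalIntegrable _ _
  · exact (continuous_of_continuousOn_pos hg' hp).aestronglyMeasurable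
  · exact Eventually.of_forall fun t ht q hq => hM (q, t) ⟨hq, uIoc_subset_uIcc ht⟩
  · exact intervalIntegrable_const
  · exact Eventually.of_forall fun t _ q hq => hd q t (by linarith [hq.1])

lemma hasStrictFDerivAt_integral_left (hg : ContinuousOn (Function.uncurry g) (Ioi 0 ×ˢ univ))
    (hg' : ContinuousOn (Function.uncurry g') (Ioi 0 ×ˢ univ))
    (hd : ∀ p t, 0 < p → HasDerivAt (fun q => g q t) (g' p t) p) (b : ℝ) {z : ℝ × ℝ}
    (hz : 0 < z.2) :
    HasStrictFDerivAt (fun z : ℝ × ℝ => ∫ t in z.1..b, g z.2 t)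
      (planeForm (-g z.2 z.1) (∫ t in z.1..b, g' z.2 t)) z := by
  refine hasStrictFDerivAt_of_partials (U := {z | 0 < z.2})
    (f₁ := fun z => -g z.2 z.1) (f₂ := fun z => ∫ t in z.1..b, g' z.2 t)
    (isOpen_lt continuous_const continuous_snd) ?_ ?_ ?_ (continuousOn_integral_left hg' b) hz
  · intro w hw
    have hc := continuous_of_continuousOn_pos hg hw
    exact intervalIntegral.integral_hasDerivAt_left (hc.intervalIntegrable _ _)
      (hc.stronglyMeasurableAtFilter _ _) hc.continuousAt
  · intro w hw
    exact hasDerivAt_integral_param hg hg' hd w.1 b hw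
  · refine ContinuousOn.neg ?_
    exact hg.comp (f := fun z : ℝ × ℝ => (z.2, z.1)) (by fun_prop)
      (fun w hw => ⟨hw, mem_univ _⟩)

end ParametricIntegral

/-! ### Elliptic integrals over [α, π/2] and their partial derivatives. -/

section TailIntegrals

/-- `√(cos² t + p² sin² t)`, which is `√(1 - k² sin² t)` for the complementary modulus `p`. -/
noncomputable def ellDelta (p t : ℝ) : ℝ := Real.sqrt (Real.cos t ^ 2 + p ^ 2 * Real.sin t ^ 2)

/-- `K - F(α)`, as a function of `α` and the complementary modulus `p`. -/
noncomputable def tailF (α p : ℝ) : ℝ := ∫ t in α..(Real.pi / 2), (ellDelta p t)⁻¹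

/-- `E - E(α)`, as a function of `α` and the complementary modulus `p`. -/
noncomputable def tailE (α p : ℝ) : ℝ := ∫ t in α..(Real.pi / 2), ellDelta p t

/-- Minus the logarithmic derivative of `dn` at the point of amplitude `α`. -/
noncomputable def dnSlope (α p : ℝ) : ℝ :=
  (1 - p ^ 2) * (Real.sin α * Real.cos α) * (ellDelta p α)⁻¹

lemma ellDelta_radicand_pos {p : ℝ} (hp : 0 < p) (t : ℝ) :
    0 < Real.cos t ^ 2 + p ^ 2 * Real.sin t ^ 2 := by
  rcases eq_or_ne (Real.cos t) 0 with h | h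
  · have : Real.sin t ^ 2 = 1 := by have := Real.sin_sq_add_cos_sq t; rw [h] at this; linarith
    rw [this]; positivity
  · positivity

lemma ellDelta_pos {p : ℝ} (hp : 0 < p) (t : ℝ) : 0 < ellDelta p t :=
  Real.sqrt_pos.2 (ellDelta_radicand_pos hp t)

lemma ellDelta_sq (p t : ℝ) : ellDelta p t ^ 2 = Real.cos t ^ 2 + p ^ 2 * Real.sin t ^ 2 :=
  Real.sq_sqrt (by positivity)

lemma ellDelta_sq' (p t : ℝ) : ellDelta p t ^ 2 = 1 - (1 - p ^ 2) * Real.sin t ^ 2 := by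
  rw [ellDelta_sq, Real.cos_sq']; ring

lemma abs_cos_le_ellDelta (p t : ℝ) : |Real.cos t| ≤ ellDelta p t :=
  Real.abs_le_sqrt (by nlinarith [sq_nonneg (p * Real.sin t)])

lemma cos_le_ellDelta (p t : ℝ) : Real.cos t ≤ ellDelta p t :=
  (le_abs_self _).trans (abs_cos_le_ellDelta p t)

lemma ellDelta_nonneg (p t : ℝ) : 0 ≤ ellDelta p t := Real.sqrt_nonneg _

lemma le_ellDelta {p : ℝ} (h1 : p ≤ 1) (hp : 0 < p) (t : ℝ) : p ≤ ellDelta p t := by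
  refine Real.le_sqrt_of_sq_le ?_
  have := Real.sin_sq_add_cos_sq t
  nlinarith [sq_nonneg (Real.cos t), mul_nonneg (by nlinarith : 0 ≤ 1 - p ^ 2)
    (sq_nonneg (Real.cos t))]

lemma ellDelta_le_one {p : ℝ} (h1 : p ≤ 1) (hp : 0 < p) (t : ℝ) : ellDelta p t ≤ 1 := by
  refine Real.sqrt_le_one.2 ?_
  have := Real.sin_sq_add_cos_sq t
  nlinarith [mul_nonneg (by nlinarith : 0 ≤ 1 - p ^ 2) (sq_nonneg (Real.sin t))]

lemma ellDelta_le {p : ℝ} (hp : 0 < p) (t : ℝ) : ellDelta p t ≤ |Real.cos t| + p := by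
  refine Real.sqrt_le_iff.2 ⟨by positivity, ?_⟩
  nlinarith [sq_abs (Real.cos t), mul_nonneg (abs_nonneg (Real.cos t)) hp.le,
    Real.sin_sq_le_one t, mul_le_mul_of_nonneg_left (Real.sin_sq_le_one t) (sq_nonneg p)]

lemma continuous_ellDelta : Continuous (Function.uncurry ellDelta) := by
  unfold ellDelta Function.uncurry
  fun_prop

lemma continuousOn_ellDelta_inv :
    ContinuousOn (Function.uncurry fun p t => (ellDelta p t)⁻¹) (Ioi 0 ×ˢ univ) :=
  continuous_ellDelta.continuousOn.inv₀ fun x hx => (ellDelta_pos hx.1 x.2).ne'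

lemma hasDerivAt_ellDelta_left {p : ℝ} (hp : 0 < p) (t : ℝ) :
    HasDerivAt (fun q => ellDelta q t) (p * (Real.sin t ^ 2 * (ellDelta p t)⁻¹)) p := by
  have h := ((((hasDerivAt_id p).pow 2).mul_const (Real.sin t ^ 2)).const_add
    (Real.cos t ^ 2)).sqrt (ellDelta_radicand_pos hp t).ne'
  refine h.congr_deriv ?_
  change _ / (2 * ellDelta p t) = _
  have := (ellDelta_pos hp t).ne'
  simp
  field_simp

lemma hasDerivAt_ellDelta_right {p : ℝ} (hp : 0 < p) (t : ℝ) :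
    HasDerivAt (ellDelta p) (-((1 - p ^ 2) * (Real.sin t * Real.cos t) * (ellDelta p t)⁻¹)) t := by
  have h := (((Real.hasDerivAt_cos t).pow 2).add (((Real.hasDerivAt_sin t).pow 2).const_mul
    (p ^ 2))).sqrt (ellDelta_radicand_pos hp t).ne'
  refine h.congr_deriv ?_
  change _ / (2 * ellDelta p t) = _
  have := (ellDelta_pos hp t).ne'
  simp
  field_simp
  ring

lemma hasDerivAt_ellDelta_inv_left {p : ℝ} (hp : 0 < p) (t : ℝ) :
    HasDerivAt (fun q => (ellDelta q t)⁻¹) (-(p * (Real.sin t ^ 2 * (ellDelta p t)⁻¹ ^ 3))) p := by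
  refine ((hasDerivAt_ellDelta_left hp t).inv (ellDelta_pos hp t).ne').congr_deriv ?_
  have := (ellDelta_pos hp t).ne'
  field_simp

lemma hasDerivAt_dnSlope_left {p : ℝ} (hp : 0 < p) (t : ℝ) :
    HasDerivAt (fun α => dnSlope α p) ((1 - p ^ 2) * (1 - 2 * Real.sin t ^ 2
      + (1 - p ^ 2) * Real.sin t ^ 4) * (ellDelta p t)⁻¹ ^ 3) t := by
  have h := (((Real.hasDerivAt_sin t).mul (Real.hasDerivAt_cos t)).const_mul (1 - p ^ 2)).mul
    ((hasDerivAt_ellDelta_right hp t).inv (ellDelta_pos hp t).ne')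
  refine h.congr_deriv ?_
  have hd := (ellDelta_pos hp t).ne'
  have h2 := ellDelta_sq' p t
  have hc := Real.cos_sq' t
  simp only [Pi.mul_apply, Pi.inv_apply]
  field_simp
  rw [h2]
  linear_combination (1 - (1 - p ^ 2) * Real.sin t ^ 2 + Real.sin t ^ 2 * (1 - p ^ 2) - p ^ 2) * hc

lemma hasDerivAt_dnSlope_right {p : ℝ} (hp : 0 < p) (t : ℝ) :
    HasDerivAt (fun q => dnSlope t q) (-(p * (Real.sin t * Real.cos t) * (1 + ellDelta p t ^ 2)
      * (ellDelta p t)⁻¹ ^ 3)) p := by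
  have h := ((((hasDerivAt_id p).pow 2).const_sub 1).mul_const (Real.sin t * Real.cos t)).mul
    (hasDerivAt_ellDelta_inv_left hp t)
  refine h.congr_deriv ?_
  have hd := (ellDelta_pos hp t).ne'
  have h2 := ellDelta_sq' p t
  simp
  field_simp
  rw [h2]
  ring

/-- The partial derivative of `tailF` in the complementary modulus, times `-p`. -/
noncomputable def tailFDecay (α p : ℝ) : ℝ :=
  (tailE α p - p ^ 2 * tailF α p + dnSlope α p) / (1 - p ^ 2)

lemma continuous_ellDelta_right (p : ℝ) : Continuous (ellDelta p) := by
  unfold ellDelta; fun_prop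

lemma continuous_ellDelta_inv_right {p : ℝ} (hp : 0 < p) : Continuous fun t => (ellDelta p t)⁻¹ :=
  (continuous_ellDelta_right p).inv₀ fun t => (ellDelta_pos hp t).ne'

/-- The integrand is a combination of Δ, 1/Δ and the α-derivative of `dnSlope`. The last one
integrates exactly, and `dnSlope` vanishes at π/2. -/
lemma integral_sin_sq_div_ellDelta_cube {p : ℝ} (hp : 0 < p) (h1 : p < 1) (α : ℝ) :
    ∫ t in α..(Real.pi / 2), -(p * (Real.sin t ^ 2 * (ellDelta p t)⁻¹ ^ 3))
      = -tailFDecay α p / p := by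
  have c1 := continuous_ellDelta_right p
  have c2 := continuous_ellDelta_inv_right hp
  have hS : ∫ t in α..(Real.pi / 2), (1 - p ^ 2) * (1 - 2 * Real.sin t ^ 2
      + (1 - p ^ 2) * Real.sin t ^ 4) * (ellDelta p t)⁻¹ ^ 3 = -dnSlope α p := by
    rw [intervalIntegral.integral_eq_sub_of_hasDerivAt
      (fun t _ => hasDerivAt_dnSlope_left hp t)
      (Continuous.intervalIntegrable (by fun_prop) _ _)]
    simp [dnSlope]
  have hk : 1 - p ^ 2 ≠ 0 := by nlinarith
  have hpt : ∀ t, -(p * (Real.sin t ^ 2 * (ellDelta p t)⁻¹ ^ 3)) =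
      -(1 / (p * (1 - p ^ 2))) * (ellDelta p t - p ^ 2 * (ellDelta p t)⁻¹
        - (1 - p ^ 2) * (1 - 2 * Real.sin t ^ 2
      + (1 - p ^ 2) * Real.sin t ^ 4) * (ellDelta p t)⁻¹ ^ 3) := by
    intro t
    have hd := (ellDelta_pos hp t).ne'
    have h2 := ellDelta_sq' p t
    field_simp
    rw [h2]
    ring
  simp_rw [hpt]
  rw [intervalIntegral.integral_const_mul, intervalIntegral.integral_sub,
    intervalIntegral.integral_sub, intervalIntegral.integral_const_mul, hS]
  · unfold tailFDecay
    change _ * (tailE α p - p ^ 2 * tailF α p - _) = _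
    field_simp
    ring
  all_goals exact Continuous.intervalIntegrable (by fun_prop) _ _

lemma integral_sin_sq_div_ellDelta {p : ℝ} (hp : 0 < p) (h1 : p < 1) (α : ℝ) :
    ∫ t in α..(Real.pi / 2), p * (Real.sin t ^ 2 * (ellDelta p t)⁻¹)
      = p * (tailF α p - tailE α p) / (1 - p ^ 2) := by
  have c1 := continuous_ellDelta_right p
  have c2 := continuous_ellDelta_inv_right hp
  have hk : 1 - p ^ 2 ≠ 0 := by nlinarith
  have hpt : ∀ t, p * (Real.sin t ^ 2 * (ellDelta p t)⁻¹) =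
      (p / (1 - p ^ 2)) * ((ellDelta p t)⁻¹ - ellDelta p t) := by
    intro t
    have hd := (ellDelta_pos hp t).ne'
    have h2 := ellDelta_sq' p t
    field_simp
    rw [h2]; ring
  simp_rw [hpt]
  rw [intervalIntegral.integral_const_mul, intervalIntegral.integral_sub]
  · change _ * (tailF α p - tailE α p) = _
    ring
  all_goals exact Continuous.intervalIntegrable (by fun_prop) _ _

lemma hasStrictFDerivAt_tailF {z : ℝ × ℝ} (hz : 0 < z.2) (h1 : z.2 < 1) :
    HasStrictFDerivAt (fun z : ℝ × ℝ => tailF z.1 z.2)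
      (planeForm (-(ellDelta z.2 z.1)⁻¹) (-tailFDecay z.1 z.2 / z.2)) z := by
  rw [← integral_sin_sq_div_ellDelta_cube hz h1]
  refine hasStrictFDerivAt_integral_left (g := fun p t => (ellDelta p t)⁻¹)
    (g' := fun p t => -(p * (Real.sin t ^ 2 * (ellDelta p t)⁻¹ ^ 3))) continuousOn_ellDelta_inv
    ?_ (fun p t hp => hasDerivAt_ellDelta_inv_left hp t) _ hz
  have := continuousOn_ellDelta_inv
  simp only [Function.uncurry_def] at this ⊢
  fun_prop

lemma hasStrictFDerivAt_tailE {z : ℝ × ℝ} (hz : 0 < z.2) (h1 : z.2 < 1) :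
    HasStrictFDerivAt (fun z : ℝ × ℝ => tailE z.1 z.2)
      (planeForm (-ellDelta z.2 z.1) (z.2 * (tailF z.1 z.2 - tailE z.1 z.2) / (1 - z.2 ^ 2)))
      z := by
  rw [← integral_sin_sq_div_ellDelta hz h1]
  refine hasStrictFDerivAt_integral_left (g := ellDelta)
    (g' := fun p t => p * (Real.sin t ^ 2 * (ellDelta p t)⁻¹)) continuous_ellDelta.continuousOn
    ?_ (fun p t hp => hasDerivAt_ellDelta_left hp t) _ hz
  have := continuousOn_ellDelta_inv
  simp only [Function.uncurry_def] at this ⊢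
  fun_prop

lemma hasStrictFDerivAt_dnSlope {z : ℝ × ℝ} (hz : 0 < z.2) :
    HasStrictFDerivAt (fun z : ℝ × ℝ => dnSlope z.1 z.2)
      (planeForm ((1 - z.2 ^ 2) * (1 - 2 * Real.sin z.1 ^ 2
        + (1 - z.2 ^ 2) * Real.sin z.1 ^ 4) * (ellDelta z.2 z.1)⁻¹ ^ 3)
        (-(z.2 * (Real.sin z.1 * Real.cos z.1) * (1 + ellDelta z.2 z.1 ^ 2)
      * (ellDelta z.2 z.1)⁻¹ ^ 3))) z := by
  have c1 : Continuous fun z : ℝ × ℝ => ellDelta z.2 z.1 := by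
    unfold ellDelta; fun_prop
  have c2 : ContinuousOn (fun z : ℝ × ℝ => (ellDelta z.2 z.1)⁻¹) {z | 0 < z.2} :=
    c1.continuousOn.inv₀ fun z hz => (ellDelta_pos hz z.1).ne'
  refine hasStrictFDerivAt_of_partials (U := {z : ℝ × ℝ | 0 < z.2})
    (f := fun z => dnSlope z.1 z.2)
    (f₁ := fun z => (1 - z.2 ^ 2) * (1 - 2 * Real.sin z.1 ^ 2
        + (1 - z.2 ^ 2) * Real.sin z.1 ^ 4) * (ellDelta z.2 z.1)⁻¹ ^ 3)
    (f₂ := fun z => -(z.2 * (Real.sin z.1 * Real.cos z.1) * (1 + ellDelta z.2 z.1 ^ 2)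
      * (ellDelta z.2 z.1)⁻¹ ^ 3))
    (isOpen_lt continuous_const continuous_snd) ?_ ?_ ?_ ?_ hz
  · exact fun w hw => hasDerivAt_dnSlope_left hw _
  · exact fun w hw => hasDerivAt_dnSlope_right hw _
  · exact ContinuousOn.mul (by fun_prop) (c2.pow 3)
  · exact (ContinuousOn.mul (by fun_prop) (c2.pow 3)).neg

end TailIntegrals

/-! ### Estimates and injectivity for small α and p. -/

section SmallBox

/-- The region of small amplitudes and small complementary moduli. -/
def smallBox : Set (ℝ × ℝ) := Ioo (-(1 / 10)) (1 / 10) ×ˢ Ioo 0 (1 / 100)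

lemma convex_smallBox : Convex ℝ smallBox := (convex_Ioo _ _).prod (convex_Ioo _ _)

lemma isOpen_smallBox : IsOpen smallBox := isOpen_Ioo.prod isOpen_Ioo

variable {α p : ℝ}

lemma abs_sin_le_of_mem_smallBox (h : (α, p) ∈ smallBox) : |Real.sin α| ≤ 1 / 10 :=
  Real.abs_sin_le_abs.trans (abs_le.2 ⟨h.1.1.le, h.1.2.le⟩)

lemma sin_sq_le_of_mem_smallBox (h : (α, p) ∈ smallBox) : Real.sin α ^ 2 ≤ 1 / 100 := by
  have := abs_sin_le_of_mem_smallBox h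
  rw [← sq_abs]
  nlinarith [abs_nonneg (Real.sin α)]

lemma p_sq_le_of_mem_smallBox (h : (α, p) ∈ smallBox) : p ^ 2 ≤ 1 / 10000 := by
  have h1 : 0 < p := h.2.1
  have h2 : p < 1 / 100 := h.2.2
  nlinarith

lemma le_ellDelta_of_mem_smallBox (h : (α, p) ∈ smallBox) : 9 / 10 ≤ ellDelta p α := by
  refine Real.le_sqrt_of_sq_le ?_
  have h1 := sin_sq_le_of_mem_smallBox h
  have h2 := Real.cos_sq' α
  nlinarith [mul_nonneg (sq_nonneg p) (sq_nonneg (Real.sin α))]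

lemma ellDelta_le_one_of_mem_smallBox (h : (α, p) ∈ smallBox) : ellDelta p α ≤ 1 :=
  ellDelta_le_one (by have : p < 1 / 100 := h.2.2; linarith) h.2.1 α

lemma ellDelta_inv_le_of_mem_smallBox (h : (α, p) ∈ smallBox) :
    (ellDelta p α)⁻¹ ≤ 10 / 9 := by
  have := inv_anti₀ (by norm_num) (le_ellDelta_of_mem_smallBox h)
  linarith

lemma one_le_ellDelta_inv_of_mem_smallBox (h : (α, p) ∈ smallBox) :
    1 ≤ (ellDelta p α)⁻¹ :=
  (one_le_inv₀ (ellDelta_pos h.2.1 α)).2 (ellDelta_le_one_of_mem_smallBox h)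

lemma one_sub_sin_le_tailE (hα : α ≤ Real.pi / 2) (p : ℝ) : 1 - Real.sin α ≤ tailE α p := by
  have h : ∫ t in α..(Real.pi / 2), Real.cos t = 1 - Real.sin α := by simp
  rw [← h]
  exact intervalIntegral.integral_mono_on hα (Real.continuous_cos.intervalIntegrable _ _)
    ((continuous_ellDelta_right p).intervalIntegrable _ _) fun t _ => cos_le_ellDelta p t

lemma tailE_le_tailF (hα : α ≤ Real.pi / 2) (hp : 0 < p) (h1 : p ≤ 1) : tailE α p ≤ tailF α p :=
  intervalIntegral.integral_mono_on hα ((continuous_ellDelta_right p).intervalIntegrable _ _)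
    ((continuous_ellDelta_inv_right hp).intervalIntegrable _ _) fun t _ =>
    (ellDelta_le_one h1 hp t).trans
      ((one_le_inv₀ (ellDelta_pos hp t)).2 (ellDelta_le_one h1 hp t))

lemma tailF_mul_le (hα : α ≤ Real.pi / 2) (hp : 0 < p) (h1 : p ≤ 1) :
    p * tailF α p ≤ Real.pi / 2 - α := by
  have h : tailF α p ≤ ∫ _ in α..(Real.pi / 2), p⁻¹ :=
    intervalIntegral.integral_mono_on hα ((continuous_ellDelta_inv_right hp).intervalIntegrable _ _)
      intervalIntegrable_const fun t _ => inv_anti₀ hp (le_ellDelta h1 hp t)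
  rw [intervalIntegral.integral_const, smul_eq_mul] at h
  calc p * tailF α p ≤ p * ((Real.pi / 2 - α) * p⁻¹) := by gcongr
    _ = _ := by field_simp

lemma le_half_pi_of_mem_smallBox (h : (α, p) ∈ smallBox) : α ≤ Real.pi / 2 := by
  have : α < 1 / 10 := h.1.2
  linarith [Real.pi_gt_three]

lemma le_tailE_of_mem_smallBox (h : (α, p) ∈ smallBox) : 9 / 10 ≤ tailE α p := by
  have := one_sub_sin_le_tailE (le_half_pi_of_mem_smallBox h) p
  have := (abs_le.1 (abs_sin_le_of_mem_smallBox h)).2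
  linarith

lemma tailE_le_tailF_of_mem_smallBox (h : (α, p) ∈ smallBox) : tailE α p ≤ tailF α p :=
  tailE_le_tailF (le_half_pi_of_mem_smallBox h) h.2.1 (by have : p < 1 / 100 := h.2.2; linarith)

lemma sq_mul_tailF_le_of_mem_smallBox (h : (α, p) ∈ smallBox) : p ^ 2 * tailF α p ≤ 1 / 50 := by
  have h1 : 0 < p := h.2.1
  have h2 : p < 1 / 100 := h.2.2
  have h3 : -(1 / 10) < α := h.1.1
  have := tailF_mul_le (le_half_pi_of_mem_smallBox h) h1 (by linarith)
  have h4 : p * tailF α p ≤ 2 := by linarith [Real.pi_lt_d2]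
  nlinarith

lemma abs_dnSlope_le_of_mem_smallBox (h : (α, p) ∈ smallBox) : |dnSlope α p| ≤ 1 / 9 := by
  unfold dnSlope
  have h1 := p_sq_le_of_mem_smallBox h
  have h2 := abs_sin_le_of_mem_smallBox h
  have h3 := ellDelta_inv_le_of_mem_smallBox h
  have h4 := inv_nonneg.2 (ellDelta_nonneg p α)
  rw [abs_mul, abs_mul, abs_mul, abs_of_nonneg h4, abs_of_nonneg (by linarith : 0 ≤ 1 - p ^ 2)]
  calc (1 - p ^ 2) * (|Real.sin α| * |Real.cos α|) * (ellDelta p α)⁻¹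
      ≤ 1 * (1 / 10 * 1) * (10 / 9) := by
        gcongr
        · nlinarith [sq_nonneg p]
        · exact Real.abs_cos_le_one α
    _ = 1 / 9 := by norm_num

/-- The derivative of `dnSlope` in the amplitude. -/
noncomputable def dnSlopeRate (α p : ℝ) : ℝ :=
  (1 - p ^ 2) * (1 - 2 * Real.sin α ^ 2 + (1 - p ^ 2) * Real.sin α ^ 4) * (ellDelta p α)⁻¹ ^ 3

lemma le_dnSlopeRate_of_mem_smallBox (h : (α, p) ∈ smallBox) : 1 / 2 ≤ dnSlopeRate α p := by
  unfold dnSlopeRate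
  have h1 := p_sq_le_of_mem_smallBox h
  have h2 := sin_sq_le_of_mem_smallBox h
  have h3 := one_le_ellDelta_inv_of_mem_smallBox h
  have h4 : 0 ≤ (1 - p ^ 2) * Real.sin α ^ 4 :=
    mul_nonneg (by linarith) (by positivity)
  have h5 : 9 / 10 ≤ 1 - p ^ 2 := by linarith
  have h6 : 9 / 10 ≤ 1 - 2 * Real.sin α ^ 2 + (1 - p ^ 2) * Real.sin α ^ 4 := by linarith
  have h7 : 1 ≤ (ellDelta p α)⁻¹ ^ 3 := one_le_pow₀ h3
  have h8 := mul_le_mul h5 h6 (by norm_num) (by linarith)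
  have h9 := mul_le_mul h8 h7 (by norm_num) (by linarith)
  linarith

/-- The derivative of `dnSlope / √(1 + p²)` in `p`, times `-p √(1 + p²)`. -/
noncomputable def dnSlopeDrift (α p : ℝ) : ℝ :=
  p ^ 2 * (dnSlope α p / (1 + p ^ 2)
    + Real.sin α * Real.cos α * (1 + ellDelta p α ^ 2) * (ellDelta p α)⁻¹ ^ 3)

lemma abs_dnSlopeDrift_le_of_mem_smallBox (h : (α, p) ∈ smallBox) :
    |dnSlopeDrift α p| ≤ p ^ 2 / 2 := by
  unfold dnSlopeDrift
  have h2 := abs_sin_le_of_mem_smallBox h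
  have h3 := ellDelta_inv_le_of_mem_smallBox h
  have h4 := inv_nonneg.2 (ellDelta_nonneg p α)
  have h5 := ellDelta_le_one_of_mem_smallBox h
  have h6 := ellDelta_nonneg p α
  have hA : |dnSlope α p / (1 + p ^ 2)| ≤ 1 / 9 := by
    rw [abs_div, abs_of_pos (by positivity : 0 < 1 + p ^ 2)]
    exact (div_le_self (abs_nonneg _) (by nlinarith [sq_nonneg p])).trans
      (abs_dnSlope_le_of_mem_smallBox h)
  have hB : |Real.sin α * Real.cos α * (1 + ellDelta p α ^ 2) * (ellDelta p α)⁻¹ ^ 3| ≤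
      1 / 10 * 1 * (1 + 1 ^ 2) * (10 / 9) ^ 3 := by
    rw [abs_mul, abs_mul, abs_mul, abs_of_nonneg (pow_nonneg h4 3),
      abs_of_nonneg (by positivity : 0 ≤ 1 + ellDelta p α ^ 2)]
    gcongr
    exact Real.abs_cos_le_one α
  rw [abs_mul, abs_of_nonneg (sq_nonneg p), div_eq_mul_one_div (p ^ 2)]
  refine mul_le_mul_of_nonneg_left ((abs_add_le _ _).trans ?_) (sq_nonneg p)
  linarith

/-- The derivative of `√(1 + p²) tailF` in `p`, times `-p / √(1 + p²)`. -/
noncomputable def tailRate (α p : ℝ) : ℝ :=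
  tailFDecay α p - p ^ 2 * tailF α p / (1 + p ^ 2)

lemma tailF_nonneg_of_mem_smallBox (h : (α, p) ∈ smallBox) : 0 ≤ tailF α p := by
  linarith [le_tailE_of_mem_smallBox h, tailE_le_tailF_of_mem_smallBox h]

lemma le_tailRate_of_mem_smallBox (h : (α, p) ∈ smallBox) : 1 / 2 ≤ tailRate α p := by
  have h1 := p_sq_le_of_mem_smallBox h
  have h2 := (abs_le.1 (abs_dnSlope_le_of_mem_smallBox h)).1
  have h3 := le_tailE_of_mem_smallBox h
  have h4 := sq_mul_tailF_le_of_mem_smallBox h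
  have h5 := tailF_nonneg_of_mem_smallBox h
  have hA : 3 / 4 ≤ tailFDecay α p := by
    unfold tailFDecay
    rw [le_div_iff₀ (by linarith)]
    nlinarith [sq_nonneg p]
  have hB : p ^ 2 * tailF α p / (1 + p ^ 2) ≤ 1 / 50 :=
    (div_le_self (by positivity) (by nlinarith [sq_nonneg p])).trans h4
  unfold tailRate
  linarith

lemma hasStrictFDerivAt_sqrt_one_add_sq (z : ℝ × ℝ) :
    HasStrictFDerivAt (fun z : ℝ × ℝ => Real.sqrt (1 + z.2 ^ 2))
      (planeForm 0 (z.2 / Real.sqrt (1 + z.2 ^ 2))) z := by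
  have h : HasStrictDerivAt (fun y : ℝ => Real.sqrt (1 + y ^ 2))
      (z.2 / Real.sqrt (1 + z.2 ^ 2)) z.2 := by
    refine (((hasStrictDerivAt_pow 2 z.2).const_add 1).sqrt (by positivity)).congr_deriv ?_
    have : Real.sqrt (1 + z.2 ^ 2) ≠ 0 := by positivity
    simp
    field_simp
  refine (h.hasStrictFDerivAt.comp z hasStrictFDerivAt_snd).congr_fderiv ?_
  ext <;> simp [planeForm]

lemma hasStrictFDerivAt_dnSlope_div {z : ℝ × ℝ} (hz : 0 < z.2) :
    HasStrictFDerivAt (fun z : ℝ × ℝ => dnSlope z.1 z.2 / Real.sqrt (1 + z.2 ^ 2))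
      (planeForm (dnSlopeRate z.1 z.2 / Real.sqrt (1 + z.2 ^ 2))
        (-(dnSlopeDrift z.1 z.2 / z.2 / Real.sqrt (1 + z.2 ^ 2)))) z := by
  have hr : Real.sqrt (1 + z.2 ^ 2) ≠ 0 := by positivity
  have hr2 : Real.sqrt (1 + z.2 ^ 2) ^ 2 = 1 + z.2 ^ 2 := Real.sq_sqrt (by positivity)
  have h := (hasStrictFDerivAt_dnSlope hz).mul
    ((hasStrictDerivAt_inv hr).hasStrictFDerivAt.comp z (hasStrictFDerivAt_sqrt_one_add_sq z))
  refine (h.congr_of_eventuallyEq ?_).congr_fderiv ?_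
  · exact Filter.Eventually.of_forall fun w => by simp [div_eq_mul_inv]
  · have hd := (ellDelta_pos hz z.1).ne'
    have h3 : 1 + z.2 ^ 2 ≠ 0 := by positivity
    ext
    · simp [planeForm, dnSlopeRate]
      field_simp
    · simp [planeForm, dnSlopeDrift, dnSlopeRate]
      generalize Real.sqrt (1 + z.2 ^ 2) = r at hr hr2 ⊢
      rw [← hr2] at h3 ⊢
      field_simp
      ring

lemma hasStrictFDerivAt_tailF_mul {z : ℝ × ℝ} (hz : 0 < z.2) (h1 : z.2 < 1) :
    HasStrictFDerivAt (fun z : ℝ × ℝ => tailF z.1 z.2 * Real.sqrt (1 + z.2 ^ 2))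
      (planeForm (-((ellDelta z.2 z.1)⁻¹ * Real.sqrt (1 + z.2 ^ 2)))
        (-(tailRate z.1 z.2 / z.2 * Real.sqrt (1 + z.2 ^ 2)))) z := by
  have hr : Real.sqrt (1 + z.2 ^ 2) ≠ 0 := by positivity
  have hr2 : Real.sqrt (1 + z.2 ^ 2) ^ 2 = 1 + z.2 ^ 2 := Real.sq_sqrt (by positivity)
  refine ((hasStrictFDerivAt_tailF hz h1).mul
    (hasStrictFDerivAt_sqrt_one_add_sq z)).congr_fderiv ?_
  have hd := (ellDelta_pos hz z.1).ne'
  ext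
  · simp [planeForm]
    field_simp
  · simp [planeForm, tailRate]
    generalize Real.sqrt (1 + z.2 ^ 2) = r at hr hr2 ⊢
    rw [← hr2]
    field_simp
    ring

/-- On `smallBox` the amplitude and the complementary modulus are determined by the normalized
slope of `dn` at the defect and the normalized length of the remaining arc. -/
lemma eq_of_mem_smallBox {z w : ℝ × ℝ} (hz : z ∈ smallBox) (hw : w ∈ smallBox)
    (h₁ : dnSlope z.1 z.2 / Real.sqrt (1 + z.2 ^ 2) = dnSlope w.1 w.2 / Real.sqrt (1 + w.2 ^ 2))
    (h₂ : tailF z.1 z.2 * Real.sqrt (1 + z.2 ^ 2) = tailF w.1 w.2 * Real.sqrt (1 + w.2 ^ 2)) :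
    z = w := by
  -- The mean value theorem yields a different intermediate point for each function, so no single
  -- Jacobian is available. Uniform bounds replace it: the first equation gives |a| ≤ x.2 |b|, the
  -- second |b| ≤ |a| / 2, and both increments vanish.
  obtain ⟨x, hx, hx'⟩ := domain_mvt (fun v (hv : v ∈ smallBox) =>
    (hasStrictFDerivAt_dnSlope_div hv.2.1).hasFDerivAt.hasFDerivWithinAt) convex_smallBox hz hw
  obtain ⟨y, hy, hy'⟩ := domain_mvt (fun v (hv : v ∈ smallBox) =>
    (hasStrictFDerivAt_tailF_mul hv.2.1 (by have : v.2 < 1 / 100 := hv.2.2; linarith)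
      ).hasFDerivAt.hasFDerivWithinAt) convex_smallBox hz hw
  replace hx := convex_smallBox.segment_subset hz hw hx
  replace hy := convex_smallBox.segment_subset hz hw hy
  rw [← h₁, sub_self, planeForm_apply] at hx'
  rw [← h₂, sub_self, planeForm_apply] at hy'
  set a := (w - z).1 with ha
  set b := (w - z).2 with hb
  have hxp : 0 < x.2 := hx.2.1
  have hyp : 0 < y.2 := hy.2.1
  have hx1 : x.2 < 1 / 100 := hx.2.2
  have hy1 : y.2 < 1 / 100 := hy.2.2
  have hrx : 0 < Real.sqrt (1 + x.2 ^ 2) := by positivity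
  have hry : 0 < Real.sqrt (1 + y.2 ^ 2) := by positivity
  have e1 : x.2 * dnSlopeRate x.1 x.2 * a = dnSlopeDrift x.1 x.2 * b := by
    field_simp at hx'
    linarith
  have e2 : tailRate y.1 y.2 * b = -(y.2 * (ellDelta y.2 y.1)⁻¹ * a) := by
    have : (ellDelta y.2 y.1)⁻¹ * a + tailRate y.1 y.2 / y.2 * b = 0 := by
      apply mul_right_cancel₀ hry.ne'
      linarith
    field_simp at this ⊢
    linarith
  have e1' : |a| ≤ x.2 * |b| := by
    have h := congrArg abs e1
    have hr := le_dnSlopeRate_of_mem_smallBox hx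
    have hd := abs_dnSlopeDrift_le_of_mem_smallBox hx
    have hr' : 0 < dnSlopeRate x.1 x.2 := by linarith
    rw [abs_mul, abs_mul (dnSlopeDrift x.1 x.2), abs_of_pos (mul_pos hxp hr')] at h
    have h3 : x.2 * (1 / 2) * |a| ≤ x.2 ^ 2 / 2 * |b| := by
      calc x.2 * (1 / 2) * |a| ≤ x.2 * dnSlopeRate x.1 x.2 * |a| := by gcongr
        _ = _ := h
        _ ≤ _ := by gcongr
    have h4 : x.2 * |a| ≤ x.2 * (x.2 * |b|) := by nlinarith
    exact le_of_mul_le_mul_left h4 hxp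
  have e2' : |b| ≤ 1 / 2 * |a| := by
    have h := congrArg abs e2
    have hr := le_tailRate_of_mem_smallBox hy
    have hd := ellDelta_inv_le_of_mem_smallBox hy
    have hd' := one_le_ellDelta_inv_of_mem_smallBox hy
    rw [abs_neg, abs_mul, abs_mul (y.2 * _), abs_of_pos (by linarith : 0 < tailRate y.1 y.2),
      abs_of_pos (mul_pos hyp (by linarith))] at h
    have h3 : 1 / 2 * |b| ≤ 1 / 100 * (10 / 9) * |a| := by
      calc 1 / 2 * |b| ≤ tailRate y.1 y.2 * |b| := by gcongr
        _ = _ := h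
        _ ≤ _ := by gcongr
    linarith [abs_nonneg a]
  have hb0 : |b| = 0 := by nlinarith [abs_nonneg a, abs_nonneg b]
  have ha0 : |a| = 0 := by
    rw [hb0] at e1'
    linarith [abs_nonneg a]
  rw [abs_eq_zero] at ha0 hb0
  ext
  · simp only [ha, Prod.fst_sub] at ha0; linarith
  · simp only [hb, Prod.snd_sub] at hb0; linarith

lemma half_sub_le_cos {t : ℝ} (h1 : -(1 / 10) < t) (h2 : t ≤ Real.pi / 2) :
    (Real.pi / 2 - t) / 2 ≤ Real.cos t := by
  rcases le_or_gt 0 t with h | h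
  · have := Real.mul_le_sin (x := Real.pi / 2 - t) (by linarith) (by linarith)
    rw [Real.sin_pi_div_two_sub] at this
    refine le_trans ?_ this
    have hp : (1 / 2 : ℝ) ≤ 2 / Real.pi := by
      rw [le_div_iff₀ Real.pi_pos]; linarith [Real.pi_le_four]
    nlinarith
  · have := Real.one_sub_sq_div_two_le_cos (x := t)
    nlinarith [Real.pi_lt_d2]

/-- G grows only logarithmically in 1/p: averaging Δ ≥ p and Δ ≥ cos t ≥ (π/2 − t)/2 gives G ≤ −4
log p ≤ 8/√p. This is what makes powers of G times p² harmless. -/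
lemma tailF_sq_mul_le_of_mem_smallBox (h : (α, p) ∈ smallBox) : tailF α p ^ 2 * p ≤ 64 := by
  have hp : 0 < p := h.2.1
  have hp1 : p < 1 / 100 := h.2.2
  have hα : -(1 / 10) < α := h.1.1
  have hα' := le_half_pi_of_mem_smallBox h
  have hpos : ∀ t ∈ uIcc α (Real.pi / 2), 0 < p + (Real.pi / 2 - t) / 2 := by
    intro t ht
    rw [uIcc_of_le hα'] at ht
    linarith [ht.2]
  have hint : IntervalIntegrable (fun t => 2 / (p + (Real.pi / 2 - t) / 2)) MeasureTheory.volume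
      α (Real.pi / 2) := by
    refine ContinuousOn.intervalIntegrable ?_
    exact continuousOn_const.div (by fun_prop) fun t ht => (hpos t ht).ne'
  have h1 : tailF α p ≤ ∫ t in α..(Real.pi / 2), 2 / (p + (Real.pi / 2 - t) / 2) := by
    refine intervalIntegral.integral_mono_on hα'
      ((continuous_ellDelta_inv_right hp).intervalIntegrable _ _) hint fun t ht => ?_
    have h2 := half_sub_le_cos (lt_of_lt_of_le hα ht.1) ht.2
    have h3 := cos_le_ellDelta p t
    have h4 := le_ellDelta (by linarith) hp t
    have h5 := hpos t (by rw [uIcc_of_le hα']; exact ht)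
    rw [← one_div, div_le_div_iff₀ (ellDelta_pos hp t) h5]
    linarith
  have h2 : ∫ t in α..(Real.pi / 2), 2 / (p + (Real.pi / 2 - t) / 2) =
      4 * Real.log (p + (Real.pi / 2 - α) / 2) - 4 * Real.log p := by
    rw [intervalIntegral.integral_eq_sub_of_hasDerivAt
      (f := fun t => -4 * Real.log (p + (Real.pi / 2 - t) / 2)) ?_ hint]
    · simp; ring
    · intro t ht
      refine (((((hasDerivAt_id t).const_sub (Real.pi / 2)).div_const 2).const_add p).log
        (hpos t ht).ne' |>.const_mul (-4)).congr_deriv ?_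
      have := (hpos t ht).ne'
      simp only [id]
      field_simp
      norm_num
  have h3 : Real.log (p + (Real.pi / 2 - α) / 2) ≤ 0 :=
    Real.log_nonpos (by linarith) (by linarith [Real.pi_lt_d2])
  have hs : 0 < Real.sqrt p := Real.sqrt_pos.2 hp
  have hsq : Real.sqrt p ^ 2 = p := Real.sq_sqrt hp.le
  have h4 : -Real.log p ≤ 2 * (Real.sqrt p)⁻¹ := by
    have := Real.log_le_sub_one_of_pos (inv_pos.2 hs)
    rw [Real.log_inv] at this
    have h5 : Real.log p = 2 * Real.log (Real.sqrt p) := by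
      conv_lhs => rw [← hsq]
      rw [Real.log_pow]; norm_num
    rw [h5]; linarith
  have h5 : tailF α p * Real.sqrt p ≤ 8 := by
    calc tailF α p * Real.sqrt p ≤ 8 * (Real.sqrt p)⁻¹ * Real.sqrt p := by gcongr; linarith
      _ = 8 := by field_simp
  have h6 : 0 ≤ tailF α p * Real.sqrt p := mul_nonneg (tailF_nonneg_of_mem_smallBox h) hs.le
  calc tailF α p ^ 2 * p = (tailF α p * Real.sqrt p) ^ 2 := by rw [mul_pow, hsq]
    _ ≤ 8 ^ 2 := by gcongr
    _ = 64 := by norm_num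

end SmallBox

/-! ### Differentiability of the curve of peaks and monotonicity of G E. -/

section DerivativeSign

/-- Bounds for the solution of the linearized constraints. -/
lemma linearized_bounds {p G S R e i T a q : ℝ} (hp2 : p ^ 2 ≤ 1 / 10000) (hG : 1000 ≤ G)
    (hi : 0 ≤ i) (hi1 : i ≤ 10 / 9) (hR : 1 / 2 ≤ R) (he : |e| ≤ p ^ 2 / 2)
    (hT : 1 / 2 ≤ T) (hS : |S| ≤ 1 / 9) (hpG1 : p ^ 2 * G ≤ 1 / 50)
    (h₁ : R * a - e * q = -S) (h₂ : i * a + T * q = -G) :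
    |a| ≤ 3 * |S| + 3 * (p ^ 2 * G) ∧ |q| ≤ 3 * G := by
  -- The coupling of `q` into the first equation has size p². Inserting the bound for `q` therefore
  -- closes the estimate for `a`, with the factor 2 relaxed to 3.
  have ha1 : 1 / 2 * |a| ≤ |S| + p ^ 2 / 2 * |q| := by
    calc 1 / 2 * |a| ≤ R * |a| := by gcongr
      _ = |R * a| := by rw [abs_mul, abs_of_nonneg (by linarith : 0 ≤ R)]
      _ = |-S + e * q| := by congr 1; linarith
      _ ≤ |S| + |e| * |q| := by
          refine (abs_add_le _ _).trans ?_
          rw [abs_neg, abs_mul]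
      _ ≤ _ := by gcongr
  have hq1 : 1 / 2 * |q| ≤ G + 10 / 9 * |a| := by
    calc 1 / 2 * |q| ≤ T * |q| := by gcongr
      _ = |T * q| := by rw [abs_mul, abs_of_nonneg (by linarith : 0 ≤ T)]
      _ = |-G + -(i * a)| := by congr 1; linarith
      _ ≤ |G| + |i * a| := by
          refine (abs_add_le _ _).trans ?_
          rw [abs_neg, abs_neg]
      _ ≤ G + 10 / 9 * |a| := by
          rw [abs_mul, abs_of_nonneg (by linarith : 0 ≤ G), abs_of_nonneg hi]
          gcongr
  have ha0 := abs_nonneg a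
  have hpa : p ^ 2 * |a| ≤ 1 / 10000 * |a| := by gcongr
  have hpq : p ^ 2 * (1 / 2 * |q|) ≤ p ^ 2 * (G + 10 / 9 * |a|) := by gcongr
  have hS0 := abs_nonneg S
  have hpG0 : 0 ≤ p ^ 2 * G := mul_nonneg (sq_nonneg p) (by linarith)
  have ha2 : |a| ≤ 3 * |S| + 3 * (p ^ 2 * G) := by linarith
  exact ⟨ha2, by linarith⟩

/-- The sign of the derivative of `tailF * tailE`, from the linearized constraints: `a` and `q` are
the derivatives of the amplitude and of the logarithm of the complementary modulus, and
`G`, `E`, `S` are the values of `tailF`, `tailE`, `dnSlope`. -/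
lemma product_deriv_pos {p G E S D R e i P a q C : ℝ} (hp : 0 < p) (hp2 : p ^ 2 ≤ 1 / 10000)
    (hE : 9 / 10 ≤ E) (hEG : E ≤ G) (hD : 0 ≤ D) (hD1 : D ≤ 1)
    (hi : 0 ≤ i) (hi1 : i ≤ 10 / 9) (hR : 1 / 2 ≤ R) (he : |e| ≤ p ^ 2 / 2)
    (hT : 1 / 2 ≤ P - p ^ 2 * G / (1 + p ^ 2)) (hS : |S| ≤ 1 / 9) (hpG : G ^ 2 * p ≤ 64)
    (hpG1 : p ^ 2 * G ≤ 1 / 50) (hSG : |S| * G ≤ C) (hG : 13000 + 4 * C ≤ G)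
    (h₁ : R * a - e * q = -S)
    (h₂ : i * a + (P - p ^ 2 * G / (1 + p ^ 2)) * q = -G) :
    0 < (-i * a - P * q) * E + G * (-D * a + p ^ 2 * (G - E) / (1 - p ^ 2) * q) := by
  have hC0 : 0 ≤ C := le_trans (mul_nonneg (abs_nonneg S) (by linarith)) hSG
  have hG0 : 0 ≤ G := by linarith
  obtain ⟨ha2, hq2⟩ := linearized_bounds hp2 (by linarith) hi hi1 hR he hT hS hpG1 h₁ h₂
  have ha0 := abs_nonneg a
  have hq0 := abs_nonneg q
  have hpG0 : 0 ≤ p ^ 2 * G := by positivity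
  -- From p²G⁴ ≤ 64² = 4096, dividing by G ≥ 13000; this is where 13000 comes from.
  have hG3 : p ^ 2 * G ^ 3 ≤ 1 / 3 := by
    have h4 : (G ^ 2 * p) ^ 2 ≤ 64 ^ 2 := pow_le_pow_left₀ (by positivity) hpG 2
    have h5 : p ^ 2 * G ^ 3 * 13000 ≤ p ^ 2 * G ^ 3 * G :=
      mul_le_mul_of_nonneg_left (by linarith) (by positivity)
    linarith
  have hG2 : p ^ 2 * G ^ 2 ≤ 1 / 3 := by
    have h5 : p ^ 2 * G ^ 2 * 1 ≤ p ^ 2 * G ^ 2 * G :=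
      mul_le_mul_of_nonneg_left (by linarith) (by positivity)
    linarith
  have hA : G - 1 ≤ -i * a - P * q := by
    have h3 : -i * a - P * q = G - p ^ 2 * G / (1 + p ^ 2) * q := by linarith
    have h4 : p ^ 2 * G / (1 + p ^ 2) * q ≤ 1 := by
      have h5 : p ^ 2 * G / (1 + p ^ 2) ≤ p ^ 2 * G :=
        div_le_self hpG0 (by linarith [sq_nonneg p])
      calc p ^ 2 * G / (1 + p ^ 2) * q ≤ p ^ 2 * G / (1 + p ^ 2) * |q| :=
            mul_le_mul_of_nonneg_left (le_abs_self q) (by positivity)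
        _ ≤ p ^ 2 * G * (3 * G) := mul_le_mul h5 hq2 hq0 hpG0
        _ ≤ 1 := by linarith
    linarith
  have hk : p ^ 2 * (G - E) / (1 - p ^ 2) ≤ 2 * (p ^ 2 * G) := by
    rw [div_le_iff₀ (by linarith)]
    have h1 : 0 ≤ p ^ 2 * E := mul_nonneg (sq_nonneg p) (by linarith)
    have h2 : p ^ 2 * G * p ^ 2 ≤ p ^ 2 * G * (1 / 10000) := by gcongr
    linarith
  have hk0 : 0 ≤ p ^ 2 * (G - E) / (1 - p ^ 2) :=
    div_nonneg (mul_nonneg (sq_nonneg p) (by linarith)) (by linarith)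
  have h5 : |-D * a + p ^ 2 * (G - E) / (1 - p ^ 2) * q| ≤ |a| + 2 * (p ^ 2 * G) * (3 * G) := by
    refine (abs_add_le _ _).trans ?_
    rw [abs_mul, abs_mul, abs_neg, abs_of_nonneg hD, abs_of_nonneg hk0]
    exact add_le_add (mul_le_of_le_one_left ha0 hD1) (mul_le_mul hk hq2 hq0 (by linarith))
  have h6 : G * (|a| + 2 * (p ^ 2 * G) * (3 * G)) ≤ 3 * C + 3 := by
    have : G * |a| ≤ G * (3 * |S| + 3 * (p ^ 2 * G)) := by gcongr
    linarith
  have hB : -(3 * C + 3) ≤ G * (-D * a + p ^ 2 * (G - E) / (1 - p ^ 2) * q) := by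
    have := mul_le_mul_of_nonneg_left (abs_le.1 h5).1 hG0
    linarith
  -- The main term. It beats the loss 3C + 3 because 0.9 · 4C ≥ 3C, which explains the 4C in the
  -- bound on G.
  have hC : (G - 1) * (9 / 10) ≤ (-i * a - P * q) * E :=
    mul_le_mul hA hE (by norm_num) (by linarith)
  linarith

lemma hasDerivAt_of_planeForm {f : ℝ × ℝ → ℝ} {a b : ℝ} {c : ℝ → ℝ × ℝ} {v : ℝ × ℝ} {w : ℝ}
    (hf : HasStrictFDerivAt f (planeForm a b) (c w)) (hc : HasDerivAt c v w) :
    HasDerivAt (fun t => f (c t)) (a * v.1 + b * v.2) w := by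
  have := hf.hasFDerivAt.comp_hasDerivAt w hc
  rw [planeForm_apply] at this
  exact this

lemma exists_equiv_of_planeForm {a b c d : ℝ} (h : a * d - b * c ≠ 0) :
    ∃ e : (ℝ × ℝ) ≃L[ℝ] (ℝ × ℝ),
      (e : (ℝ × ℝ) →L[ℝ] (ℝ × ℝ)) = (planeForm a b).prod (planeForm c d) := by
  set A := (planeForm a b).prod (planeForm c d)
  have hA : Function.Injective (A : (ℝ × ℝ) →ₗ[ℝ] (ℝ × ℝ)) := by
    rw [injective_iff_map_eq_zero]
    intro z hz
    have h1 : a * z.1 + b * z.2 = 0 := by simpa [A] using congrArg Prod.fst hz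
    have h2 : c * z.1 + d * z.2 = 0 := by simpa [A] using congrArg Prod.snd hz
    ext
    · refine mul_left_cancel₀ h ?_
      simp only [Prod.fst_zero]
      linear_combination d * h1 - b * h2
    · refine mul_left_cancel₀ h ?_
      simp only [Prod.snd_zero]
      linear_combination a * h2 - c * h1
  refine ⟨(LinearEquiv.ofInjectiveEndo _ hA).toContinuousLinearEquiv, ?_⟩
  ext <;> rfl

/-- If a curve in `smallBox` solves two scalar equations with differentiable right hand sides, then
it is differentiable. -/
lemma exists_hasDerivAt_of_constraints {c : ℝ → ℝ × ℝ} {u v : ℝ → ℝ} {u' v' w : ℝ}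
    (hc : ∀ᶠ t in nhds w, c t ∈ smallBox)
    (hu : ∀ᶠ t in nhds w, dnSlope (c t).1 (c t).2 / Real.sqrt (1 + (c t).2 ^ 2) = u t)
    (hv : ∀ᶠ t in nhds w, tailF (c t).1 (c t).2 * Real.sqrt (1 + (c t).2 ^ 2) = v t)
    (hu' : HasDerivAt u u' w) (hv' : HasDerivAt v v' w) : ∃ c', HasDerivAt c c' w := by
  have hw := hc.self_of_nhds
  have hp : 0 < (c w).2 := hw.2.1
  have hp1 : (c w).2 < 1 / 100 := hw.2.2
  set f : ℝ × ℝ → ℝ × ℝ := fun z => (dnSlope z.1 z.2 / Real.sqrt (1 + z.2 ^ 2),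
    tailF z.1 z.2 * Real.sqrt (1 + z.2 ^ 2)) with hf
  have hdet : dnSlopeRate (c w).1 (c w).2 / Real.sqrt (1 + (c w).2 ^ 2)
        * (-(tailRate (c w).1 (c w).2 / (c w).2 * Real.sqrt (1 + (c w).2 ^ 2)))
      - (-(dnSlopeDrift (c w).1 (c w).2 / (c w).2 / Real.sqrt (1 + (c w).2 ^ 2)))
        * (-((ellDelta (c w).2 (c w).1)⁻¹ * Real.sqrt (1 + (c w).2 ^ 2))) ≠ 0 := by
    have hr : Real.sqrt (1 + (c w).2 ^ 2) ≠ 0 := by positivity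
    have h1 := le_dnSlopeRate_of_mem_smallBox hw
    have h2 := le_tailRate_of_mem_smallBox hw
    have h3 := abs_dnSlopeDrift_le_of_mem_smallBox hw
    have h4 := ellDelta_inv_le_of_mem_smallBox hw
    have h5 := p_sq_le_of_mem_smallBox hw
    have h6 : dnSlopeRate (c w).1 (c w).2 * tailRate (c w).1 (c w).2
        + dnSlopeDrift (c w).1 (c w).2 * (ellDelta (c w).2 (c w).1)⁻¹ ≠ 0 := by
      have h7 : |dnSlopeDrift (c w).1 (c w).2 * (ellDelta (c w).2 (c w).1)⁻¹|
          ≤ (1 / 10000) / 2 * (10 / 9) := by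
        rw [abs_mul, abs_of_nonneg (inv_nonneg.2 (ellDelta_nonneg _ _))]
        exact mul_le_mul (by linarith) h4 (inv_nonneg.2 (ellDelta_nonneg _ _)) (by norm_num)
      have h8 := (abs_le.1 h7).1
      nlinarith
    intro h
    apply h6
    have h9 := (ellDelta_pos hp (c w).1).ne'
    field_simp at h ⊢
    linarith
  obtain ⟨e, he⟩ := exists_equiv_of_planeForm hdet
  have hstrict : HasStrictFDerivAt f (e : (ℝ × ℝ) →L[ℝ] (ℝ × ℝ)) (c w) := by
    rw [he]
    exact (hasStrictFDerivAt_dnSlope_div hp).prodMk (hasStrictFDerivAt_tailF_mul hp (by linarith))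
  have hfw : f (c w) = (u w, v w) := Prod.ext hu.self_of_nhds hv.self_of_nhds
  have hinv := hstrict.to_localInverse.hasFDerivAt
  rw [hfw] at hinv
  have hcomp := hinv.comp_hasDerivAt w (f := fun t => (u t, v t)) (hu'.prodMk hv')
  refine ⟨_, hcomp.congr_of_eventuallyEq ?_⟩
  -- Continuity of `c` is not assumed. The local inverse applied to (u, v) solves the same equations
  -- inside `smallBox`, so injectivity there forces it to equal `c`.
  have hcont : Filter.Tendsto (fun t => (u t, v t)) (nhds w) (nhds (f (c w))) := by
    rw [hfw]
    exact (hu'.prodMk hv').continuousAt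
  have h1 := hcont.eventually hstrict.eventually_right_inverse
  have h2 := (hstrict.localInverse_tendsto.comp hcont).eventually (isOpen_smallBox.mem_nhds hw)
  filter_upwards [hc, hu, hv, h1, h2] with t ht1 ht2 ht3 ht4 ht5
  have h6 := congrArg Prod.fst ht4
  have h7 := congrArg Prod.snd ht4
  exact eq_of_mem_smallBox ht1 ht5 (ht2.trans h6.symm) (ht3.trans h7.symm)

/-- Along the curve of dnoidal peaks of fixed period and defect strength, the product
`(K - F(α)) (E - E(α))` has positive derivative in the frequency. -/
lemma exists_pos_hasDerivAt_tailF_mul_tailE {c : ℝ → ℝ × ℝ} {L Z w : ℝ} (hw : 0 < w)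
    (hc : ∀ᶠ t in nhds w, c t ∈ smallBox)
    (hu : ∀ᶠ t in nhds w, dnSlope (c t).1 (c t).2 / Real.sqrt (1 + (c t).2 ^ 2)
      = Z / (2 * Real.sqrt t))
    (hv : ∀ᶠ t in nhds w, tailF (c t).1 (c t).2 * Real.sqrt (1 + (c t).2 ^ 2) = L * Real.sqrt t)
    (hG : 13000 + 4 * |L * Z / 2| ≤ tailF (c w).1 (c w).2) :
    ∃ d, 0 < d ∧ HasDerivAt (fun t => tailF (c t).1 (c t).2 * tailE (c t).1 (c t).2) d w := by
  have hs : 0 < Real.sqrt w := Real.sqrt_pos.2 hw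
  have hs2 : Real.sqrt w ^ 2 = w := Real.sq_sqrt hw.le
  have hu' : HasDerivAt (fun t => Z / (2 * Real.sqrt t)) (-(Z / (2 * Real.sqrt w)) / (2 * w)) w := by
    have h := (((Real.hasDerivAt_sqrt hw.ne').const_mul 2).inv (by positivity)).const_mul Z
    refine (h.congr_of_eventuallyEq (Filter.Eventually.of_forall fun t => by
      simp [div_eq_mul_inv])).congr_deriv ?_
    generalize Real.sqrt w = s at hs hs2 ⊢
    rw [← hs2]
    field_simp
  have hv' : HasDerivAt (fun t => L * Real.sqrt t) (L * Real.sqrt w / (2 * w)) w := by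
    refine ((Real.hasDerivAt_sqrt hw.ne').const_mul L).congr_deriv ?_
    generalize Real.sqrt w = s at hs hs2 ⊢
    rw [← hs2]
    field_simp
  obtain ⟨c', hc'⟩ := exists_hasDerivAt_of_constraints hc hu hv hu' hv'
  have hbox := hc.self_of_nhds
  have huw := hu.self_of_nhds
  have hvw := hv.self_of_nhds
  have hp : 0 < (c w).2 := hbox.2.1
  have hp1 : (c w).2 < 1 / 100 := hbox.2.2
  have hp1' : (c w).2 < 1 := by linarith
  have d1 := (hasDerivAt_of_planeForm (hasStrictFDerivAt_dnSlope_div hp) hc').unique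
    (hu'.congr_of_eventuallyEq hu)
  have d2 := (hasDerivAt_of_planeForm (hasStrictFDerivAt_tailF_mul hp hp1') hc').unique
    (hv'.congr_of_eventuallyEq hv)
  have d3 := (hasDerivAt_of_planeForm (hasStrictFDerivAt_tailF hp hp1') hc').mul
    (hasDerivAt_of_planeForm (hasStrictFDerivAt_tailE hp hp1') hc')
  refine ⟨_, ?_, d3⟩
  rw [← huw] at d1
  rw [← hvw] at d2
  set α := (c w).1
  set p := (c w).2
  have hr : 0 < Real.sqrt (1 + p ^ 2) := by positivity
  have hr2 : Real.sqrt (1 + p ^ 2) ^ 2 = 1 + p ^ 2 := Real.sq_sqrt (by positivity)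
  -- Multiplying the two constraints cancels both √w and √(1+p²).
  have hSG : |dnSlope α p| * tailF α p ≤ |L * Z / 2| := by
    have h0 : 0 ≤ tailF α p := tailF_nonneg_of_mem_smallBox hbox
    rw [← abs_of_nonneg h0, ← abs_mul]
    apply le_of_eq
    congr 1
    calc dnSlope α p * tailF α p
        = (dnSlope α p / Real.sqrt (1 + p ^ 2)) * (tailF α p * Real.sqrt (1 + p ^ 2)) := by
          field_simp
      _ = Z / (2 * Real.sqrt w) * (L * Real.sqrt w) := by rw [huw, hvw]
      _ = L * Z / 2 := by field_simp
  have key := product_deriv_pos (a := 2 * w * c'.1) (q := 2 * w * c'.2 / p) hp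
    (p_sq_le_of_mem_smallBox hbox) (le_tailE_of_mem_smallBox hbox) (tailE_le_tailF_of_mem_smallBox hbox) (ellDelta_nonneg p α)
    (ellDelta_le_one_of_mem_smallBox hbox) (inv_nonneg.2 (ellDelta_nonneg p α))
    (ellDelta_inv_le_of_mem_smallBox hbox) (le_dnSlopeRate_of_mem_smallBox hbox)
    (abs_dnSlopeDrift_le_of_mem_smallBox hbox) (le_tailRate_of_mem_smallBox hbox)
    (abs_dnSlope_le_of_mem_smallBox hbox) (tailF_sq_mul_le_of_mem_smallBox hbox)
    (sq_mul_tailF_le_of_mem_smallBox hbox) hSG hG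
    (by
      field_simp at d1 ⊢
      linarith)
    (by
      change _ + tailRate α p * _ = _
      have : (ellDelta p α)⁻¹ * c'.1 + tailRate α p / p * c'.2 = -(tailF α p / (2 * w)) := by
        apply mul_right_cancel₀ hr.ne'
        linear_combination -d2
      have h3 : (ellDelta p α)⁻¹ * (2 * w * c'.1) + tailRate α p * (2 * w * c'.2 / p)
        = 2 * w * ((ellDelta p α)⁻¹ * c'.1 + tailRate α p / p * c'.2) := by ring
      rw [h3, this]
      change _ = -tailF α p
      field_simp)
  have h2w : 0 < 2 * w := by linarith
  refine pos_of_mul_pos_left (b := 2 * w) (lt_of_lt_of_eq key ?_) h2w.le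
  change (_ - tailFDecay α p * _) * tailE α p
    + tailF α p * (_ + p ^ 2 * (tailF α p - tailE α p) / _ * _) = _
  field_simp
  ring

end DerivativeSign

/-! ### The Jacobi functions expressed through the amplitude. -/

section JacobiFunctions

variable {k p : ℝ}

lemma sqrt_eq_ellDelta (hk : k ^ 2 = 1 - p ^ 2) (t : ℝ) :
    Real.sqrt (1 - k ^ 2 * Real.sin t ^ 2) = ellDelta p t := by
  rw [hk, ← ellDelta_sq', Real.sqrt_sq (ellDelta_nonneg p t)]

lemma ellipticF_eq (hk : k ^ 2 = 1 - p ^ 2) (φ : ℝ) :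
    ellipticF k φ = ∫ t in (0 : ℝ)..φ, (ellDelta p t)⁻¹ := by
  simp only [ellipticF, sqrt_eq_ellDelta hk, one_div]

lemma hasDerivAt_ellipticF (hk : k ^ 2 = 1 - p ^ 2) (hp : 0 < p) (φ : ℝ) :
    HasDerivAt (ellipticF k) (ellDelta p φ)⁻¹ φ := by
  have hc := continuous_ellDelta_inv_right hp
  rw [show ellipticF k = fun φ => ∫ t in (0 : ℝ)..φ, (ellDelta p t)⁻¹ from
    funext (ellipticF_eq hk)]
  exact intervalIntegral.integral_hasDerivAt_right (hc.intervalIntegrable _ _)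
    (hc.stronglyMeasurableAtFilter _ _) hc.continuousAt

lemma strictMono_ellipticF (hk : k ^ 2 = 1 - p ^ 2) (hp : 0 < p) : StrictMono (ellipticF k) :=
  strictMono_of_hasDerivAt_pos (hasDerivAt_ellipticF hk hp)
    fun φ => inv_pos.2 (ellDelta_pos hp φ)

lemma ellipticF_neg (k φ : ℝ) : ellipticF k (-φ) = -ellipticF k φ := by
  have h := intervalIntegral.integral_comp_neg (a := 0) (b := φ)
    (fun t => 1 / Real.sqrt (1 - k ^ 2 * Real.sin t ^ 2))
  simp only [Real.sin_neg, even_two, Even.neg_pow, neg_zero] at h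
  unfold ellipticF
  rw [h, intervalIntegral.integral_symm]

lemma jacobiDn_ellipticF (hk : k ^ 2 = 1 - p ^ 2) (hp : 0 < p) (φ : ℝ) :
    jacobiDn k (ellipticF k φ) = ellDelta p φ := by
  unfold jacobiDn jacobiSn jacobiAm
  rw [Function.leftInverse_invFun (strictMono_ellipticF hk hp).injective φ, sqrt_eq_ellDelta hk]

lemma tailF_eq_sub (hk : k ^ 2 = 1 - p ^ 2) (hp : 0 < p) (α : ℝ) :
    tailF α p = ellipticK k - ellipticF k α := by
  have hc := continuous_ellDelta_inv_right hp
  rw [ellipticK, ellipticF_eq hk, ellipticF_eq hk, tailF,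
    intervalIntegral.integral_interval_sub_left] <;> exact hc.intervalIntegrable _ _

lemma injOn_ellDelta (hp : 0 < p) (h1 : p < 1) :
    InjOn (ellDelta p) (Icc 0 (Real.pi / 2)) := by
  intro x hx y hy hxy
  have h := congrArg (· ^ 2) hxy
  simp only [ellDelta_sq'] at h
  have hk : 0 < 1 - p ^ 2 := by nlinarith
  have h2 : Real.sin x ^ 2 = Real.sin y ^ 2 := by
    apply mul_left_cancel₀ hk.ne'
    linarith
  have hsx := Real.sin_nonneg_of_nonneg_of_le_pi hx.1 (by linarith [hx.2, Real.pi_pos])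
  have hsy := Real.sin_nonneg_of_nonneg_of_le_pi hy.1 (by linarith [hy.2, Real.pi_pos])
  exact Real.injOn_sin ⟨by linarith [hx.1, Real.pi_pos], hx.2⟩
    ⟨by linarith [hy.1, Real.pi_pos], hy.2⟩ ((sq_eq_sq₀ hsx hsy).1 h2)

/-- Every point of [0, K] is F of some amplitude in [0, π/2], where Δ is injective; hence the
preimage chosen by `invFunOn` is the expected one. -/
lemma jacobiDnInv_ellDelta (hk : k ^ 2 = 1 - p ^ 2) (hp : 0 < p) (h1 : p < 1) {A : ℝ}
    (hA : A ∈ Icc 0 (Real.pi / 2)) : jacobiDnInv k (ellDelta p A) = ellipticF k A := by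
  have hmono := strictMono_ellipticF hk hp
  have h0 : ellipticF k 0 = 0 := by simp [ellipticF]
  have himg : Icc 0 (ellipticK k) ⊆ ellipticF k '' Icc 0 (Real.pi / 2) := by
    have hc : Continuous (ellipticF k) :=
      continuous_iff_continuousAt.2 fun x => (hasDerivAt_ellipticF hk hp x).continuousAt
    have := intermediate_value_Icc (f := ellipticF k) (a := 0) (b := Real.pi / 2)
      (by positivity) hc.continuousOn
    rwa [h0] at this
  have hinj : InjOn (jacobiDn k) (Icc 0 (ellipticK k)) := by
    intro u hu v hv huv
    obtain ⟨x, hx, rfl⟩ := himg hu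
    obtain ⟨y, hy, rfl⟩ := himg hv
    rw [jacobiDn_ellipticF hk hp, jacobiDn_ellipticF hk hp] at huv
    rw [injOn_ellDelta hp h1 hx hy huv]
  have hmem : ellipticF k A ∈ Icc 0 (ellipticK k) := by
    rw [← h0]
    exact ⟨hmono.monotone hA.1, hmono.monotone hA.2⟩
  have := hinj.leftInvOn_invFunOn hmem
  rwa [jacobiDn_ellipticF hk hp] at this

/-- The change of variables from the argument of `dn` to the amplitude. -/
lemma integral_jacobiDn_sq (hk : k ^ 2 = 1 - p ^ 2) (hp : 0 < p) (α : ℝ) :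
    ∫ u in (ellipticF k α)..(ellipticK k), jacobiDn k u ^ 2 = tailE α p := by
  have h := intervalIntegral.integral_comp_mul_deriv_of_deriv_nonneg (a := α) (b := Real.pi / 2)
    (f := ellipticF k) (f' := fun t => (ellDelta p t)⁻¹) (g := fun u => jacobiDn k u ^ 2)
    (fun x _ => (hasDerivAt_ellipticF hk hp x).continuousAt.continuousWithinAt)
    (fun x _ => hasDerivAt_ellipticF hk hp x) (fun x _ => inv_nonneg.2 (ellDelta_nonneg p x))
  rw [ellipticK, ← h, tailE]
  refine intervalIntegral.integral_congr fun t _ => ?_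
  simp only [Function.comp, jacobiDn_ellipticF hk hp]
  have := (ellDelta_pos hp t).ne'
  field_simp

end JacobiFunctions

/-! ### The peak in the coordinates (α, p): jump, period and norm. -/

section PeakParameters

lemma integral_comp_abs_symm (f : ℝ → ℝ) {L : ℝ} (hL : 0 ≤ L)
    (hf : IntervalIntegrable f MeasureTheory.volume 0 L) :
    ∫ x in (-L)..L, f |x| = 2 * ∫ x in (0 : ℝ)..L, f x := by
  have h1 : ∫ x in (0 : ℝ)..L, f |x| = ∫ x in (0 : ℝ)..L, f x := by
    refine intervalIntegral.integral_congr fun x hx => ?_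
    rw [uIcc_of_le hL] at hx
    simp only [abs_of_nonneg hx.1]
  have h2 : ∫ x in (-L)..0, f |x| = ∫ x in (0 : ℝ)..L, f |x| := by
    have := intervalIntegral.integral_comp_neg (a := 0) (b := L) (fun x => f |x|)
    simp only [abs_neg, neg_zero] at this
    exact this.symm
  have i1 : IntervalIntegrable (fun x => f |x|) MeasureTheory.volume 0 L := by
    refine hf.congr fun x hx => ?_
    rw [uIoc_of_le hL] at hx
    simp only [abs_of_pos hx.1]
  have i2 : IntervalIntegrable (fun x => f |x|) MeasureTheory.volume (-L) 0 := by
    have := (i1.comp_sub_left 0).symm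
    simpa using this
  rw [← intervalIntegral.integral_add_adjacent_intervals i2 i1, h2, h1]
  ring

/-- The complementary modulus of the peak. -/
noncomputable def peakComplModulus (η ω : ℝ) : ℝ := η / peakEtaOne η ω

/-- The amplitude of the shift of the peak, with the sign of `Z`. -/
noncomputable def peakAmplitude (η ω Z : ℝ) : ℝ :=
  (if 0 < Z then 1 else -1) * Real.arcsin (Real.sqrt
    ((peakEtaOne η ω ^ 2 - peakHeight η ω Z ^ 2) / (peakEtaOne η ω ^ 2 - η ^ 2)))

/-- The admissible range of `η₂`. -/
def IsPeakRange (Z ω η : ℝ) : Prop := Z ≠ 0 ∧ Z ^ 2 / 4 < ω ∧ 0 < η ∧ η < peakTheta ω Z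

variable {Z ω η : ℝ}

lemma IsPeakRange.omega_pos (h : IsPeakRange Z ω η) : 0 < ω :=
  lt_of_le_of_lt (by positivity) h.2.1

/-- This is η₁ − η > |Z|/√2, squared and cleared of η₁. -/
lemma IsPeakRange.sq_lt (h : IsPeakRange Z ω η) : η ^ 2 + Z ^ 2 / 4 + |Z| * η / Real.sqrt 2 < ω := by
  obtain ⟨h0, h1, h2, h3⟩ := h
  unfold peakTheta at h3
  have hs : 0 < Real.sqrt 2 := by positivity
  have hs2 : Real.sqrt 2 ^ 2 = 2 := Real.sq_sqrt (by norm_num)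
  have h4 : η + Real.sqrt 2 / 4 * |Z| < Real.sqrt (ω - Z ^ 2 / 8) := by linarith
  have h5 : (η + Real.sqrt 2 / 4 * |Z|) ^ 2 < ω - Z ^ 2 / 8 := (Real.lt_sqrt (by positivity)).1 h4
  have h6 : |Z| * η / Real.sqrt 2 = |Z| * η * Real.sqrt 2 / 2 := by
    rw [div_eq_div_iff hs.ne' (by norm_num)]
    linear_combination -|Z| * η * hs2
  have h7 : (η + Real.sqrt 2 / 4 * |Z|) ^ 2 = η ^ 2 + |Z| * η * Real.sqrt 2 / 2 + Z ^ 2 / 8 := by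
    linear_combination |Z| ^ 2 / 16 * hs2 + 1 / 8 * sq_abs Z
  rw [h6]
  linarith

lemma isPeakRange_of_sq_lt (hZ : Z ≠ 0) (hη : 0 < η)
    (h : η ^ 2 + Z ^ 2 / 4 + |Z| * η / Real.sqrt 2 < ω) : IsPeakRange Z ω η := by
  have hs : 0 < Real.sqrt 2 := by positivity
  have hs2 : Real.sqrt 2 ^ 2 = 2 := Real.sq_sqrt (by norm_num)
  have h6 : |Z| * η / Real.sqrt 2 = |Z| * η * Real.sqrt 2 / 2 := by
    rw [div_eq_div_iff hs.ne' (by norm_num)]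
    linear_combination -|Z| * η * hs2
  have h7 : (η + Real.sqrt 2 / 4 * |Z|) ^ 2 = η ^ 2 + |Z| * η * Real.sqrt 2 / 2 + Z ^ 2 / 8 := by
    linear_combination |Z| ^ 2 / 16 * hs2 + 1 / 8 * sq_abs Z
  have h8 : η + Real.sqrt 2 / 4 * |Z| < Real.sqrt (ω - Z ^ 2 / 8) :=
    (Real.lt_sqrt (by positivity)).2 (by rw [h7]; linarith)
  refine ⟨hZ, ?_, hη, ?_⟩
  · have : 0 ≤ |Z| * η / Real.sqrt 2 := by positivity
    nlinarith
  · unfold peakTheta; linarith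

lemma IsPeakRange.etaOne_sq (h : IsPeakRange Z ω η) : peakEtaOne η ω ^ 2 = 2 * ω - η ^ 2 := by
  have := h.sq_lt
  have := h.2.2.1
  have h3 : 0 ≤ |Z| * η / Real.sqrt 2 := by positivity
  exact Real.sq_sqrt (by nlinarith)

lemma IsPeakRange.sq_eta_lt (h : IsPeakRange Z ω η) : η ^ 2 < ω := by
  have := h.sq_lt
  have := h.2.2.1
  have h3 : 0 ≤ |Z| * η / Real.sqrt 2 := by positivity
  have : 0 ≤ Z ^ 2 := sq_nonneg Z
  have : 0 < Z ^ 2 := by have := h.1; positivity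
  linarith

lemma IsPeakRange.sqrt_le_etaOne (h : IsPeakRange Z ω η) : Real.sqrt ω ≤ peakEtaOne η ω :=
  Real.sqrt_le_sqrt (by linarith [h.sq_eta_lt])

lemma IsPeakRange.etaOne_pos (h : IsPeakRange Z ω η) : 0 < peakEtaOne η ω :=
  lt_of_lt_of_le (Real.sqrt_pos.2 h.omega_pos) h.sqrt_le_etaOne

lemma IsPeakRange.eta_lt_etaOne (h : IsPeakRange Z ω η) : η < peakEtaOne η ω :=
  lt_of_pow_lt_pow_left₀ 2 h.etaOne_pos.le (by rw [h.etaOne_sq]; linarith [h.sq_eta_lt])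

lemma IsPeakRange.compl_pos (h : IsPeakRange Z ω η) : 0 < peakComplModulus η ω :=
  div_pos h.2.2.1 h.etaOne_pos

lemma IsPeakRange.compl_lt_one (h : IsPeakRange Z ω η) : peakComplModulus η ω < 1 :=
  (div_lt_one h.etaOne_pos).2 h.eta_lt_etaOne

lemma IsPeakRange.modulus_sq (h : IsPeakRange Z ω η) :
    peakModulus η ω ^ 2 = 1 - peakComplModulus η ω ^ 2 := by
  have h1 := h.etaOne_sq
  have h2 := h.etaOne_pos
  have h3 := h.sq_eta_lt
  unfold peakModulus peakComplModulus
  rw [Real.sq_sqrt (div_nonneg (by linarith) (by linarith [h.omega_pos])), div_pow, h1]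
  have : 2 * ω - η ^ 2 ≠ 0 := by linarith [h.omega_pos]
  field_simp
  ring

/-- `Φ²` is the larger root of its quadratic equation. -/
lemma IsPeakRange.height_sq (h : IsPeakRange Z ω η) :
    (peakEtaOne η ω ^ 2 - peakHeight η ω Z ^ 2) * (peakHeight η ω Z ^ 2 - η ^ 2)
      = Z ^ 2 / 2 * peakHeight η ω Z ^ 2 ∧ ω - Z ^ 2 / 4 ≤ peakHeight η ω Z ^ 2 := by
  have h1 := h.etaOne_sq
  have hη := h.2.2.1
  have h2 := h.sq_lt
  have hη1 := h.etaOne_pos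
  have hs : 0 < Real.sqrt 2 := by positivity
  have hs2 : Real.sqrt 2 ^ 2 = 2 := Real.sq_sqrt (by norm_num)
  -- This gap is what makes the discriminant nonnegative: it gives 2ω − Z²/2 = η₁² + η² − Z²/2 ≥
  -- 2ηη₁.
  have hgap : |Z| / Real.sqrt 2 + η ≤ peakEtaOne η ω := by
    refine le_of_sq_le_sq ?_ hη1.le
    rw [h1]
    have : (|Z| / Real.sqrt 2) ^ 2 = Z ^ 2 / 2 := by rw [div_pow, sq_abs, hs2]
    have h3 : |Z| / Real.sqrt 2 * η = |Z| * η / Real.sqrt 2 := by ring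
    nlinarith
  have hdisc : 0 ≤ (2 * ω - Z ^ 2 / 2) ^ 2 - 4 * η ^ 2 * (2 * ω - η ^ 2) := by
    have : (|Z| / Real.sqrt 2) ^ 2 = Z ^ 2 / 2 := by rw [div_pow, sq_abs, hs2]
    have h5 : (|Z| / Real.sqrt 2) ^ 2 ≤ (peakEtaOne η ω - η) ^ 2 :=
      pow_le_pow_left₀ (by positivity) (by linarith) 2
    rw [← h1]
    have h6 : 2 * (η * peakEtaOne η ω) ≤ 2 * ω - Z ^ 2 / 2 := by nlinarith
    have h7 : (2 * (η * peakEtaOne η ω)) ^ 2 ≤ (2 * ω - Z ^ 2 / 2) ^ 2 :=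
      pow_le_pow_left₀ (by positivity) h6 2
    linarith
  have hpos : 0 < 2 * ω - Z ^ 2 / 2 := by linarith [h.2.1]
  have hd := Real.sq_sqrt hdisc
  have hd0 := Real.sqrt_nonneg ((2 * ω - Z ^ 2 / 2) ^ 2 - 4 * η ^ 2 * (2 * ω - η ^ 2))
  have hΦ : peakHeight η ω Z ^ 2 = ((2 * ω - Z ^ 2 / 2)
      + Real.sqrt ((2 * ω - Z ^ 2 / 2) ^ 2 - 4 * η ^ 2 * (2 * ω - η ^ 2))) / 2 :=
    Real.sq_sqrt (by linarith)
  constructor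
  · rw [hΦ, h1]
    linear_combination -1 / 4 * hd
  · rw [hΦ]; linarith

lemma IsPeakRange.height_mem (h : IsPeakRange Z ω η) :
    η ^ 2 < peakHeight η ω Z ^ 2 ∧ peakHeight η ω Z ^ 2 < peakEtaOne η ω ^ 2 := by
  obtain ⟨h1, h2⟩ := h.height_sq
  have hΦ : 0 < peakHeight η ω Z ^ 2 := by linarith [h.2.1]
  have hZ : 0 < Z ^ 2 := by have := h.1; positivity
  have hlt : η ^ 2 < peakEtaOne η ω ^ 2 := by rw [h.etaOne_sq]; linarith [h.sq_eta_lt]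
  have hpos : 0 < (peakEtaOne η ω ^ 2 - peakHeight η ω Z ^ 2) * (peakHeight η ω Z ^ 2 - η ^ 2) := by
    rw [h1]; positivity
  rcases pos_and_pos_or_neg_and_neg_of_mul_pos hpos with h3 | h3
  · exact ⟨by linarith [h3.2], by linarith [h3.1]⟩
  · linarith [h3.1, h3.2]

lemma peakHeight_nonneg (η ω Z : ℝ) : 0 ≤ peakHeight η ω Z := Real.sqrt_nonneg _

lemma IsPeakRange.sin_amplitude_sq (h : IsPeakRange Z ω η) :
    Real.sin (peakAmplitude η ω Z) ^ 2 = (peakEtaOne η ω ^ 2 - peakHeight η ω Z ^ 2)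
      / (peakEtaOne η ω ^ 2 - η ^ 2) := by
  obtain ⟨h1, h2⟩ := h.height_mem
  have h3 : 0 ≤ (peakEtaOne η ω ^ 2 - peakHeight η ω Z ^ 2) / (peakEtaOne η ω ^ 2 - η ^ 2) :=
    div_nonneg (by linarith) (by linarith)
  have h4 : (peakEtaOne η ω ^ 2 - peakHeight η ω Z ^ 2) / (peakEtaOne η ω ^ 2 - η ^ 2) ≤ 1 :=
    (div_le_one (by linarith)).2 (by linarith)
  have h5 : Real.sin (Real.arcsin (Real.sqrt ((peakEtaOne η ω ^ 2 - peakHeight η ω Z ^ 2)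
      / (peakEtaOne η ω ^ 2 - η ^ 2)))) ^ 2 = (peakEtaOne η ω ^ 2 - peakHeight η ω Z ^ 2)
      / (peakEtaOne η ω ^ 2 - η ^ 2) := by
    rw [Real.sin_arcsin (by linarith [Real.sqrt_nonneg ((peakEtaOne η ω ^ 2
      - peakHeight η ω Z ^ 2) / (peakEtaOne η ω ^ 2 - η ^ 2))]) (Real.sqrt_le_one.2 h4),
      Real.sq_sqrt h3]
  unfold peakAmplitude
  split_ifs
  · rw [one_mul, h5]
  · rw [neg_one_mul, Real.sin_neg, neg_sq, h5]

lemma abs_peakAmplitude_mem (η ω Z : ℝ) : |peakAmplitude η ω Z| ∈ Icc 0 (Real.pi / 2) := by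
  refine ⟨abs_nonneg _, ?_⟩
  have h : |Real.arcsin (Real.sqrt ((peakEtaOne η ω ^ 2 - peakHeight η ω Z ^ 2)
      / (peakEtaOne η ω ^ 2 - η ^ 2)))| ≤ Real.pi / 2 :=
    abs_le.2 ⟨Real.neg_pi_div_two_le_arcsin _, Real.arcsin_le_pi_div_two _⟩
  unfold peakAmplitude
  split_ifs
  · rwa [one_mul]
  · rwa [neg_one_mul, abs_neg]

lemma peakAmplitude_eq (η ω Z : ℝ) :
    peakAmplitude η ω Z = (if 0 < Z then 1 else -1) * |peakAmplitude η ω Z| := by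
  have h0 : 0 ≤ Real.arcsin (Real.sqrt
      ((peakEtaOne η ω ^ 2 - peakHeight η ω Z ^ 2) / (peakEtaOne η ω ^ 2 - η ^ 2))) :=
    Real.arcsin_nonneg.2 (Real.sqrt_nonneg _)
  unfold peakAmplitude
  split_ifs
  · rw [one_mul, abs_of_nonneg h0, one_mul]
  · rw [neg_one_mul, abs_neg, abs_of_nonneg h0, neg_one_mul]

lemma IsPeakRange.ellDelta_amplitude (h : IsPeakRange Z ω η) :
    ellDelta (peakComplModulus η ω) (peakAmplitude η ω Z)
      = peakHeight η ω Z / peakEtaOne η ω := by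
  have h1 := h.etaOne_pos
  have h2 : peakEtaOne η ω ^ 2 - η ^ 2 ≠ 0 := by
    obtain ⟨h1, h2⟩ := h.height_mem; linarith
  refine (sq_eq_sq₀ (ellDelta_nonneg _ _) (div_nonneg (peakHeight_nonneg _ _ _) h1.le)).1 ?_
  rw [ellDelta_sq', h.sin_amplitude_sq, peakComplModulus]
  field_simp
  ring

lemma ellDelta_abs (p t : ℝ) : ellDelta p |t| = ellDelta p t := by
  unfold ellDelta
  rw [Real.cos_abs]
  rcases abs_choice t with h | h <;> rw [h]
  rw [Real.sin_neg, neg_sq]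

lemma IsPeakRange.shift_eq (h : IsPeakRange Z ω η) :
    peakShift η ω Z = ellipticF (peakModulus η ω) |peakAmplitude η ω Z| := by
  unfold peakShift
  rw [← h.ellDelta_amplitude, ← ellDelta_abs,
    jacobiDnInv_ellDelta h.modulus_sq h.compl_pos h.compl_lt_one (abs_peakAmplitude_mem _ _ _)]

lemma IsPeakRange.ellipticF_amplitude (h : IsPeakRange Z ω η) :
    ellipticF (peakModulus η ω) (peakAmplitude η ω Z)
      = if 0 < Z then peakShift η ω Z else -peakShift η ω Z := by
  rw [peakAmplitude_eq, h.shift_eq]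
  split_ifs
  · rw [one_mul]
  · rw [neg_one_mul, ellipticF_neg]

lemma IsPeakRange.period_eq (h : IsPeakRange Z ω η) :
    peakPeriod η ω Z = 2 * Real.sqrt 2 / peakEtaOne η ω
      * tailF (peakAmplitude η ω Z) (peakComplModulus η ω) := by
  rw [tailF_eq_sub h.modulus_sq h.compl_pos, h.ellipticF_amplitude, peakPeriod]
  split_ifs <;> ring

lemma IsPeakRange.profile_eq (h : IsPeakRange Z ω η) (ξ : ℝ) :
    peakProfile η ω Z ξ = peakEtaOne η ω * jacobiDn (peakModulus η ω)
      (peakEtaOne η ω / Real.sqrt 2 * |ξ|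
        + ellipticF (peakModulus η ω) (peakAmplitude η ω Z)) := by
  rw [peakProfile, h.ellipticF_amplitude]
  split_ifs <;> ring_nf

/-- The derivative jump φ'(0+) − φ'(0−) = −Z φ(0) at the defect. Its square is the quadratic
equation for Φ². -/
lemma IsPeakRange.dnSlope_eq (h : IsPeakRange Z ω η) :
    dnSlope (peakAmplitude η ω Z) (peakComplModulus η ω) = Z / (Real.sqrt 2 * peakEtaOne η ω) := by
  have h1 := h.etaOne_pos
  have hs : 0 < Real.sqrt 2 := by positivity
  have hs2 : Real.sqrt 2 ^ 2 = 2 := Real.sq_sqrt (by norm_num)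
  obtain ⟨hm1, hm2⟩ := h.height_mem
  obtain ⟨hq, -⟩ := h.height_sq
  have hΦ : peakHeight η ω Z ≠ 0 := by
    intro h0; rw [h0] at hm1; nlinarith [sq_nonneg η]
  have hden : peakEtaOne η ω ^ 2 - η ^ 2 ≠ 0 := by linarith
  have hp := h.compl_pos
  have habs : |dnSlope (peakAmplitude η ω Z) (peakComplModulus η ω)|
      = |Z| / (Real.sqrt 2 * peakEtaOne η ω) := by
    refine (sq_eq_sq₀ (abs_nonneg _) (by positivity)).1 ?_
    rw [sq_abs, dnSlope, h.ellDelta_amplitude]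
    simp only [mul_pow, div_pow, inv_pow]
    rw [Real.cos_sq', h.sin_amplitude_sq, peakComplModulus, sq_abs, hs2]
    field_simp
    linear_combination 2 * hq
  -- Squaring loses the sign; it is recovered because the amplitude carries the sign of Z.
  have hsgn : 0 ≤ (if 0 < Z then 1 else -1) *
      dnSlope (peakAmplitude η ω Z) (peakComplModulus η ω) := by
    obtain ⟨ha0, ha1⟩ := abs_peakAmplitude_mem η ω Z
    have hsin := Real.sin_nonneg_of_nonneg_of_le_pi ha0 (by linarith [Real.pi_pos])
    have hcos := Real.cos_nonneg_of_neg_pi_div_two_le_of_le (x := |peakAmplitude η ω Z|)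
      (by linarith [Real.pi_pos]) ha1
    have hk : 0 ≤ 1 - peakComplModulus η ω ^ 2 := by nlinarith [h.compl_lt_one]
    have hd := inv_nonneg.2 (ellDelta_nonneg (peakComplModulus η ω) (peakAmplitude η ω Z))
    have hdn : dnSlope (peakAmplitude η ω Z) (peakComplModulus η ω) = (if 0 < Z then 1 else -1) *
        ((1 - peakComplModulus η ω ^ 2) * (Real.sin |peakAmplitude η ω Z|
          * Real.cos |peakAmplitude η ω Z|)
          * (ellDelta (peakComplModulus η ω) (peakAmplitude η ω Z))⁻¹) := by
      have hsin' : Real.sin (peakAmplitude η ω Z) = (if 0 < Z then 1 else -1)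
          * Real.sin |peakAmplitude η ω Z| := by
        conv_lhs => rw [peakAmplitude_eq]
        split_ifs <;> simp
      rw [dnSlope, hsin', Real.cos_abs]
      ring
    have hone : (if 0 < Z then 1 else -1 : ℝ) * (if 0 < Z then 1 else -1) = 1 := by
      split_ifs <;> norm_num
    rw [hdn, ← mul_assoc, hone, one_mul]
    exact mul_nonneg (mul_nonneg hk (mul_nonneg hsin hcos)) hd
  split_ifs at hsgn with hZ
  · rw [one_mul] at hsgn
    rwa [abs_of_nonneg hsgn, abs_of_pos hZ] at habs
  · rw [abs_of_nonpos (by linarith), abs_of_nonpos (not_lt.1 hZ)] at habs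
    rw [← neg_inj, habs]; ring

/-- The square root of η₁² + η² = 2ω; it eliminates η₁ from the constraints, leaving only α, p and
ω. -/
lemma IsPeakRange.one_add_compl_sq (h : IsPeakRange Z ω η) :
    peakEtaOne η ω * Real.sqrt (1 + peakComplModulus η ω ^ 2) = Real.sqrt 2 * Real.sqrt ω := by
  have h1 := h.etaOne_pos
  refine (sq_eq_sq₀ (by positivity) (by positivity)).1 ?_
  rw [mul_pow, mul_pow, Real.sq_sqrt (by positivity), Real.sq_sqrt (by norm_num),
    Real.sq_sqrt h.omega_pos.le]
  rw [peakComplModulus]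
  field_simp
  rw [h.etaOne_sq]
  ring

lemma IsPeakRange.dnSlope_div_eq (h : IsPeakRange Z ω η) :
    dnSlope (peakAmplitude η ω Z) (peakComplModulus η ω)
      / Real.sqrt (1 + peakComplModulus η ω ^ 2) = Z / (2 * Real.sqrt ω) := by
  have h1 := h.etaOne_pos
  have hs2 : Real.sqrt 2 ^ 2 = 2 := Real.sq_sqrt (by norm_num)
  rw [h.dnSlope_eq, div_div, mul_assoc, h.one_add_compl_sq, ← mul_assoc, ← sq, hs2]

/-- Transfers uniqueness of p to uniqueness of η₂. -/
lemma IsPeakRange.eta_eq (h : IsPeakRange Z ω η) :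
    η = peakComplModulus η ω * (Real.sqrt 2 * Real.sqrt ω)
      / Real.sqrt (1 + peakComplModulus η ω ^ 2) := by
  have h1 := h.etaOne_pos
  have h2 : Real.sqrt (1 + peakComplModulus η ω ^ 2) ≠ 0 := by positivity
  rw [← h.one_add_compl_sq, eq_div_iff h2, peakComplModulus]
  field_simp

variable {L : ℝ}

lemma IsPeakParameter.range (h : IsPeakParameter L Z ω η) (hZ : Z ≠ 0) (hω : Z ^ 2 / 4 < ω) :
    IsPeakRange Z ω η := ⟨hZ, hω, h.1, h.2.1⟩

lemma IsPeakRange.isPeakParameter_iff (h : IsPeakRange Z ω η) :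
    IsPeakParameter L Z ω η ↔
      tailF (peakAmplitude η ω Z) (peakComplModulus η ω) = L * peakEtaOne η ω / Real.sqrt 2 := by
  have h1 := h.etaOne_pos
  have hs : 0 < Real.sqrt 2 := by positivity
  have : IsPeakParameter L Z ω η ↔ peakPeriod η ω Z = 2 * L :=
    ⟨fun h => h.2.2, fun h' => ⟨h.2.2.1, h.2.2.2, h'⟩⟩
  rw [this, h.period_eq, eq_div_iff hs.ne', div_mul_eq_mul_div, div_eq_iff h1.ne']
  constructor <;> intro h2 <;> linarith

lemma IsPeakParameter.tailF_mul_eq (hP : IsPeakParameter L Z ω η) (h : IsPeakRange Z ω η) :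
    tailF (peakAmplitude η ω Z) (peakComplModulus η ω)
      * Real.sqrt (1 + peakComplModulus η ω ^ 2) = L * Real.sqrt ω := by
  have hs : 0 < Real.sqrt 2 := by positivity
  rw [h.isPeakParameter_iff.1 hP, div_mul_eq_mul_div, mul_assoc, h.one_add_compl_sq]
  field_simp

lemma IsPeakParameter.normSq_eq (hP : IsPeakParameter L Z ω η) (h : IsPeakRange Z ω η)
    (hL : 0 < L) : peakNormSq L Z ω η = 4 / L
      * (tailF (peakAmplitude η ω Z) (peakComplModulus η ω)
        * tailE (peakAmplitude η ω Z) (peakComplModulus η ω)) := by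
  have h1 := h.etaOne_pos
  have hs : 0 < Real.sqrt 2 := by positivity
  have hs2 : Real.sqrt 2 ^ 2 = 2 := Real.sq_sqrt (by norm_num)
  have hG := h.isPeakParameter_iff.1 hP
  have hk := h.modulus_sq
  have hp := h.compl_pos
  have hK := tailF_eq_sub hk hp (peakAmplitude η ω Z)
  have hE := integral_jacobiDn_sq hk hp (peakAmplitude η ω Z)
  have hE0 : tailE (peakAmplitude η ω Z) (peakComplModulus η ω) ≠ 0 := by
    refine (intervalIntegral.intervalIntegral_pos_of_pos
      ((continuous_ellDelta_right _).intervalIntegrable _ _) (fun t => ellDelta_pos hp t) ?_).ne'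
    by_contra hle
    push Not at hle
    have : tailF (peakAmplitude η ω Z) (peakComplModulus η ω) ≤ 0 := by
      rw [tailF, intervalIntegral.integral_symm]
      exact neg_nonpos.2 (intervalIntegral.integral_nonneg hle
        fun t _ => inv_nonneg.2 (ellDelta_nonneg _ t))
    rw [hG] at this
    have : 0 < L * peakEtaOne η ω / Real.sqrt 2 := by positivity
    linarith
  set c := peakEtaOne η ω / Real.sqrt 2 with hc
  have hc0 : 0 < c := by positivity
  set F := ellipticF (peakModulus η ω) (peakAmplitude η ω Z)
  -- The period condition says that the half-period ends exactly at K, the minimum of dn.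
  have hend : c * L + F = ellipticK (peakModulus η ω) := by
    rw [hG] at hK
    rw [hc]
    linear_combination hK
  have hcv : ∫ ξ in (0 : ℝ)..L, jacobiDn (peakModulus η ω) (c * ξ + F) ^ 2
      = c⁻¹ * tailE (peakAmplitude η ω Z) (peakComplModulus η ω) := by
    rw [intervalIntegral.integral_comp_mul_add (fun u => jacobiDn (peakModulus η ω) u ^ 2)
      hc0.ne' F, mul_zero, zero_add, hend, hE, smul_eq_mul]
  have hint : IntervalIntegrable (fun ξ => (peakEtaOne η ω *
      jacobiDn (peakModulus η ω) (c * ξ + F)) ^ 2) MeasureTheory.volume 0 L := by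
    have h0 : IntervalIntegrable (fun ξ => jacobiDn (peakModulus η ω) (c * ξ + F) ^ 2)
        MeasureTheory.volume 0 L := by
      -- A non-integrable function has integral 0 by convention, whereas `hcv` and `hE0` give a
      -- nonzero value; so integrability follows without continuity of dn.
      by_contra hni
      rw [intervalIntegral.integral_undef hni] at hcv
      exact mul_ne_zero (inv_ne_zero hc0.ne') hE0 hcv.symm
    simp only [mul_pow]
    exact h0.const_mul _
  unfold peakNormSq
  simp only [h.profile_eq]
  rw [integral_comp_abs_symm (fun x => (peakEtaOne η ω *
      jacobiDn (peakModulus η ω) (c * x + F)) ^ 2) hL.le hint]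
  simp only [mul_pow]
  rw [intervalIntegral.integral_const_mul, hcv, hG, hc]
  field_simp
  rw [hs2]
  norm_num

end PeakParameters

/-! ### Existence of the peak and its location for large ω. -/

section Existence

/-- Near π/2 one has Δ ≤ p + (π/2 − t), so the last half unit of the interval already contributes a
logarithm. -/
lemma neg_log_le_tailF {α p : ℝ} (hp : 0 < p) (hα : α ≤ Real.pi / 2 - 1 / 2) :
    -Real.log (2 * p) ≤ tailF α p := by
  have hc := continuous_ellDelta_inv_right hp
  have hpos : ∀ t ∈ uIcc (Real.pi / 2 - 1 / 2) (Real.pi / 2), 0 < p + (Real.pi / 2 - t) := by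
    intro t ht
    rw [uIcc_of_le (by linarith)] at ht
    linarith [ht.2]
  have hint : IntervalIntegrable (fun t => (p + (Real.pi / 2 - t))⁻¹) MeasureTheory.volume
      (Real.pi / 2 - 1 / 2) (Real.pi / 2) :=
    (ContinuousOn.inv₀ (by fun_prop) fun t ht => (hpos t ht).ne').intervalIntegrable
  have h1 : ∫ t in (Real.pi / 2 - 1 / 2)..(Real.pi / 2), (p + (Real.pi / 2 - t))⁻¹
      = Real.log (p + 1 / 2) - Real.log p := by
    rw [intervalIntegral.integral_eq_sub_of_hasDerivAt
      (f := fun t => -Real.log (p + (Real.pi / 2 - t))) ?_ hint]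
    · simp; ring
    · intro t ht
      refine ((((hasDerivAt_id t).const_sub (Real.pi / 2)).const_add p).log
        (hpos t ht).ne').neg.congr_deriv ?_
      simp only [id]
      rw [neg_div, neg_neg, one_div]
  have h2 : ∫ t in (Real.pi / 2 - 1 / 2)..(Real.pi / 2), (p + (Real.pi / 2 - t))⁻¹
      ≤ ∫ t in (Real.pi / 2 - 1 / 2)..(Real.pi / 2), (ellDelta p t)⁻¹ := by
    refine intervalIntegral.integral_mono_on (by linarith) hint (hc.intervalIntegrable _ _)
      fun t ht => ?_
    refine inv_anti₀ (ellDelta_pos hp t) ((ellDelta_le hp t).trans ?_)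
    have h3 : 0 ≤ Real.pi / 2 - t := by linarith [ht.2]
    have h4 := Real.sin_le h3
    have h5 := Real.sin_nonneg_of_nonneg_of_le_pi h3 (by linarith [ht.1, Real.pi_gt_three])
    rw [Real.sin_pi_div_two_sub] at h4 h5
    rw [abs_of_nonneg h5]
    linarith
  have h3 : 0 ≤ ∫ t in α..(Real.pi / 2 - 1 / 2), (ellDelta p t)⁻¹ :=
    intervalIntegral.integral_nonneg hα fun t _ => inv_nonneg.2 (ellDelta_nonneg p t)
  have h4 := intervalIntegral.integral_add_adjacent_intervals
    (hc.intervalIntegrable (μ := MeasureTheory.volume) α (Real.pi / 2 - 1 / 2))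
    (hc.intervalIntegrable (μ := MeasureTheory.volume) (Real.pi / 2 - 1 / 2) (Real.pi / 2))
  have h5 : Real.log (1 / 2) ≤ Real.log (p + 1 / 2) :=
    Real.log_le_log (by norm_num) (by linarith)
  have h6 : Real.log (1 / 2) = -Real.log 2 := by rw [one_div, Real.log_inv]
  rw [Real.log_mul (by norm_num) hp.ne', tailF]
  linarith

variable {L Z ω η : ℝ}

/-- A small `dnSlope` is compatible with α near 0 and with |α| near π/2. Taking the larger root for
Φ² excludes the second. -/
lemma IsPeakRange.sin_amplitude_sq_le (h : IsPeakRange Z ω η) (hη : η ^ 2 ≤ ω / 2)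
    (hZ : Z ^ 2 ≤ ω) : Real.sin (peakAmplitude η ω Z) ^ 2 ≤ 3 / 4 := by
  have h1 := h.etaOne_sq
  have h2 := h.height_sq.2
  rw [h.sin_amplitude_sq, h1, div_le_iff₀ (by linarith [h.sq_eta_lt])]
  linarith

lemma IsPeakRange.compl_mul_tailF_le (h : IsPeakRange Z ω η) :
    peakComplModulus η ω * tailF (peakAmplitude η ω Z) (peakComplModulus η ω) ≤ Real.pi := by
  obtain ⟨h1, h2⟩ := abs_le.1 (abs_peakAmplitude_mem η ω Z).2
  linarith [tailF_mul_le h2 h.compl_pos h.compl_lt_one.le]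

/-- Here pG ≤ π with G ≥ 400 gives p < 1/100, and 4000 Z² < ω gives S² = Z²/(2η₁²) ≤ 1/8000. Since
cos² α ≥ 1/4, sin α is small, and Jordan's inequality bounds α. -/
lemma IsPeakRange.mem_smallBox (h : IsPeakRange Z ω η) (hω : 4000 * Z ^ 2 < ω)
    (hG : 400 ≤ tailF (peakAmplitude η ω Z) (peakComplModulus η ω)) :
    (peakAmplitude η ω Z, peakComplModulus η ω) ∈ smallBox := by
  have hp := h.compl_pos
  have hp1 : peakComplModulus η ω < 1 / 100 := by
    have h1 := h.compl_mul_tailF_le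
    have h2 : peakComplModulus η ω * 400
      ≤ peakComplModulus η ω * tailF (peakAmplitude η ω Z) (peakComplModulus η ω) := by gcongr
    linarith [Real.pi_lt_d2]
  have hη1 := h.etaOne_pos
  have hη : η ^ 2 ≤ ω / 2 := by
    have h1 : η < 1 / 100 * peakEtaOne η ω := (div_lt_iff₀ hη1).1 hp1
    have h2 : η ^ 2 ≤ (1 / 100 * peakEtaOne η ω) ^ 2 := pow_le_pow_left₀ h.2.2.1.le h1.le 2
    rw [mul_pow, h.etaOne_sq] at h2
    linarith [sq_nonneg η, h.omega_pos]
  have hsin := h.sin_amplitude_sq_le hη (by linarith [sq_nonneg Z])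
  obtain ⟨hα, hα'⟩ := abs_peakAmplitude_mem η ω Z
  refine ⟨?_, hp, hp1⟩
  set α := peakAmplitude η ω Z
  set p := peakComplModulus η ω
  have hs2 : Real.sqrt 2 ^ 2 = 2 := Real.sq_sqrt (by norm_num)
  have hslope : dnSlope α p ^ 2 ≤ 1 / 8000 := by
    rw [h.dnSlope_eq, div_pow, mul_pow, hs2, h.etaOne_sq,
      div_le_iff₀ (by linarith [h.sq_eta_lt, h.omega_pos])]
    linarith [h.sq_eta_lt]
  have hinv : 1 ≤ (ellDelta p α)⁻¹ ^ 2 :=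
    one_le_pow₀ ((one_le_inv₀ (ellDelta_pos hp α)).2 (ellDelta_le_one (by linarith) hp α))
  have hk : 9 / 10 ≤ (1 - p ^ 2) ^ 2 := by nlinarith
  have hcos : 1 / 4 ≤ Real.cos α ^ 2 := by rw [Real.cos_sq']; linarith
  have hsin2 : Real.sin α ^ 2 * (9 / 40) ≤ 1 / 8000 := by
    calc Real.sin α ^ 2 * (9 / 40) = 9 / 10 * (Real.sin α ^ 2 * (1 / 4)) * 1 := by ring
      _ ≤ (1 - p ^ 2) ^ 2 * (Real.sin α ^ 2 * Real.cos α ^ 2) * (ellDelta p α)⁻¹ ^ 2 := by gcongr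
      _ = dnSlope α p ^ 2 := by rw [dnSlope]; ring
      _ ≤ _ := hslope
  have hjordan := Real.mul_abs_le_abs_sin hα'
  have h4 : 1 / 2 * |α| ≤ |Real.sin α| := by
    refine le_trans ?_ hjordan
    refine mul_le_mul_of_nonneg_right ?_ (abs_nonneg α)
    rw [le_div_iff₀ Real.pi_pos]; linarith [Real.pi_le_four]
  have h5 : (1 / 2 * |α|) ^ 2 ≤ Real.sin α ^ 2 := by
    rw [← sq_abs (Real.sin α)]
    exact pow_le_pow_left₀ (by positivity) h4 2
  exact abs_lt.1 (lt_of_pow_lt_pow_left₀ 2 (by norm_num) (by linarith))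

/-- For large frequencies there is a dnoidal peak of the prescribed period. -/
lemma exists_isPeakParameter (hL : 0 < L) (hZ : Z ≠ 0) (hω : 4000 * Z ^ 2 < ω)
    (hLω : 12 < L * Real.sqrt ω) : ∃ η, IsPeakParameter L Z ω η := by
  have hω0 : 0 < ω := lt_of_le_of_lt (by positivity) hω
  set s := Real.sqrt ω with hs
  have hs0 : 0 < s := Real.sqrt_pos.2 hω0
  have hs2 : s ^ 2 = ω := Real.sq_sqrt hω0.le
  have hr0 : 0 < Real.sqrt 2 := by positivity
  have hr1 : 1 ≤ Real.sqrt 2 := Real.one_le_sqrt.2 (by norm_num)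
  have hr2 : Real.sqrt 2 ^ 2 = 2 := Real.sq_sqrt (by norm_num)
  have hrange : ∀ η, 0 < η → η ≤ 2 / 3 * s → IsPeakRange Z ω η := by
    intro η h0 h1
    refine isPeakRange_of_sq_lt hZ h0 ?_
    have h2 : |Z| ≤ s / 60 := by
      refine abs_le_of_sq_le_sq (?_ : Z ^ 2 ≤ _) (by positivity)
      rw [div_pow, hs2]; linarith [sq_nonneg Z]
    have h3 : |Z| * η / Real.sqrt 2 ≤ s / 60 * (2 / 3 * s) :=
      (div_le_self (by positivity) hr1).trans (by gcongr)
    have h4 : η ^ 2 ≤ (2 / 3 * s) ^ 2 := by gcongr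
    nlinarith
  -- Chosen so that 2p ≤ exp(−Ls); the logarithmic lower bound then gives G ≥ Ls ≥ L η₁/√2.
  set η₀ := s * (Real.exp (-(L * s)) / 4) with hη₀
  have hexp : Real.exp (-(L * s)) ≤ 1 := Real.exp_le_one_iff.2 (by linarith)
  have hη₀0 : 0 < η₀ := by positivity
  have hη₀1 : η₀ ≤ 2 / 3 * s := by
    rw [hη₀, mul_comm (2 / 3)]
    exact mul_le_mul_of_nonneg_left (by linarith) hs0.le
  set f : ℝ → ℝ := fun η => tailF (peakAmplitude η ω Z) (peakComplModulus η ω)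
    - L * peakEtaOne η ω / Real.sqrt 2 with hf
  have hcont : ContinuousOn f (Icc η₀ (2 / 3 * s)) := by
    have hr : ∀ η ∈ Icc η₀ (2 / 3 * s), IsPeakRange Z ω η :=
      fun η hη => hrange η (lt_of_lt_of_le hη₀0 hη.1) hη.2
    have c1 : Continuous fun η => peakEtaOne η ω := by unfold peakEtaOne; fun_prop
    have c2 : Continuous fun η => peakHeight η ω Z := by unfold peakHeight; fun_prop
    have c3 : ContinuousOn (fun η => peakComplModulus η ω) (Icc η₀ (2 / 3 * s)) :=
      continuousOn_id.div c1.continuousOn fun η hη => (hr η hη).etaOne_pos.ne'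
    have c4 : ContinuousOn (fun η => peakAmplitude η ω Z) (Icc η₀ (2 / 3 * s)) := by
      unfold peakAmplitude
      refine continuousOn_const.mul (Real.continuous_arcsin.comp_continuousOn
        (Real.continuous_sqrt.comp_continuousOn ?_))
      refine ContinuousOn.div (by fun_prop) (by fun_prop) fun η hη => ?_
      obtain ⟨h1, h2⟩ := (hr η hη).height_mem
      linarith
    have c5 : ContinuousOn (fun z : ℝ × ℝ => tailF z.1 z.2) {z | 0 < z.2} :=
      continuousOn_integral_left continuousOn_ellDelta_inv _
    exact (c5.comp (c4.prodMk c3) fun η hη => (hr η hη).compl_pos).sub (by fun_prop)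
  -- At this end p ≥ 1/2, so G ≤ π/p ≤ 2π < 8, while Ls > 12 makes L η₁/√2 at least 8.
  have hlow : f (2 / 3 * s) ≤ 0 := by
    have h := hrange (2 / 3 * s) (by positivity) le_rfl
    have h1 := h.compl_mul_tailF_le
    have h2 : 1 / 2 ≤ peakComplModulus (2 / 3 * s) ω := by
      rw [peakComplModulus, le_div_iff₀ h.etaOne_pos]
      refine le_of_sq_le_sq ?_ (by positivity)
      rw [mul_pow, h.etaOne_sq]
      nlinarith
    have h3 : s ≤ peakEtaOne (2 / 3 * s) ω := h.sqrt_le_etaOne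
    have h4 : 12 ≤ L * peakEtaOne (2 / 3 * s) ω :=
      hLω.le.trans (mul_le_mul_of_nonneg_left h3 hL.le)
    have h5 : 8 ≤ L * peakEtaOne (2 / 3 * s) ω / Real.sqrt 2 := by
      rw [le_div_iff₀ hr0]
      nlinarith
    have h6 : tailF (peakAmplitude (2 / 3 * s) ω Z) (peakComplModulus (2 / 3 * s) ω) ≤ 8 := by
      by_contra! hcon
      nlinarith [Real.pi_lt_d2]
    simp only [hf]
    linarith
  have hhigh : 0 ≤ f η₀ := by
    have h := hrange η₀ hη₀0 hη₀1
    have hη2 : η₀ ^ 2 ≤ ω / 2 := by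
      have : η₀ ^ 2 ≤ (2 / 3 * s) ^ 2 := by gcongr
      nlinarith
    have hsin := h.sin_amplitude_sq_le hη2 (by linarith [sq_nonneg Z])
    have hα : peakAmplitude η₀ ω Z ≤ Real.pi / 2 - 1 / 2 := by
      refine le_trans ?_ (by linarith [Real.pi_gt_three] : Real.pi / 3 ≤ Real.pi / 2 - 1 / 2)
      by_contra! hcon
      have h1 := (abs_le.1 (abs_peakAmplitude_mem η₀ ω Z).2).2
      have h2 := Real.strictMonoOn_sin
        ⟨by linarith [Real.pi_pos], by linarith [Real.pi_pos]⟩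
        ⟨by linarith [Real.pi_pos], h1⟩ hcon
      rw [Real.sin_pi_div_three] at h2
      have h3 := pow_lt_pow_left₀ h2 (by positivity) two_ne_zero
      rw [div_pow, Real.sq_sqrt (by norm_num)] at h3
      linarith
    have h1 := neg_log_le_tailF h.compl_pos hα
    have h2 : 2 * peakComplModulus η₀ ω ≤ Real.exp (-(L * s)) := by
      have h3 : peakComplModulus η₀ ω ≤ η₀ / s :=
        div_le_div_of_nonneg_left hη₀0.le hs0 h.sqrt_le_etaOne
      have h4 : η₀ / s = Real.exp (-(L * s)) / 4 := by rw [hη₀]; field_simp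
      linarith [Real.exp_pos (-(L * s))]
    have h3 : Real.log (2 * peakComplModulus η₀ ω) ≤ -(L * s) := by
      have := Real.log_le_log (by linarith [h.compl_pos]) h2
      rwa [Real.log_exp] at this
    have h4 : peakEtaOne η₀ ω ≤ s * Real.sqrt 2 := by
      refine le_of_sq_le_sq ?_ (by positivity)
      have h5 : (s * Real.sqrt 2) ^ 2 = ω * 2 := by rw [mul_pow, hs2, hr2]
      rw [h.etaOne_sq, h5]
      linarith [sq_nonneg η₀]
    have h5 : L * peakEtaOne η₀ ω / Real.sqrt 2 ≤ L * s := by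
      rw [div_le_iff₀ hr0, mul_assoc]
      gcongr
    simp only [hf]
    linarith
  obtain ⟨η, hη, hη'⟩ := intermediate_value_Icc' hη₀1 hcont ⟨hlow, hhigh⟩
  have h := hrange η (lt_of_lt_of_le hη₀0 hη.1) hη.2
  exact ⟨η, h.isPeakParameter_iff.2 (sub_eq_zero.1 hη')⟩

end Existence

/-! ### Choice of Ω and conclusion. -/

theorem theorem6p11 (L : ℝ) (hL : 0 < L) (Z : ℝ) (hZ : Z ≠ 0) :
    ∃ Ω : ℝ, Z ^ 2 / 4 ≤ Ω ∧
      (∀ ω : ℝ, Ω < ω → ∃! η : ℝ, IsPeakParameter L Z ω η) ∧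
      ∀ η₂ : ℝ → ℝ, (∀ ω : ℝ, Ω < ω → IsPeakParameter L Z ω (η₂ ω)) →
        ∀ ω : ℝ, Ω < ω →
          ∃ d : ℝ, 0 < d ∧ HasDerivAt (fun w : ℝ => peakNormSq L Z w (η₂ w)) d ω := by
  set M := 13000 + 4 * |L * Z / 2| with hM
  have hM0 : 13000 ≤ M := by linarith [abs_nonneg (L * Z / 2)]
  have hr0 : 0 < Real.sqrt 2 := by positivity
  have hr1 : 1 ≤ Real.sqrt 2 := Real.one_le_sqrt.2 (by norm_num)
  -- The first summand serves the bound on α; the second forces G = L η₁/√2 ≥ L √ω/√2 ≥ M.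
  refine ⟨4000 * Z ^ 2 + (M * Real.sqrt 2 / L) ^ 2, ?_, ?_⟩
  · linarith [sq_nonneg Z, sq_nonneg (M * Real.sqrt 2 / L)]
  set Ω := 4000 * Z ^ 2 + (M * Real.sqrt 2 / L) ^ 2 with hΩ
  have hZω : ∀ ω, Ω < ω → 4000 * Z ^ 2 < ω := fun ω h => by
    linarith [sq_nonneg (M * Real.sqrt 2 / L)]
  have hMω : ∀ ω, Ω < ω → M * Real.sqrt 2 ≤ L * Real.sqrt ω := fun ω h => by
    have h1 : M * Real.sqrt 2 / L ≤ Real.sqrt ω :=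
      Real.le_sqrt_of_sq_le (by linarith [sq_nonneg Z])
    rw [div_le_iff₀ hL] at h1
    linarith
  have hrange : ∀ ω η, Ω < ω → IsPeakParameter L Z ω η → IsPeakRange Z ω η :=
    fun ω η h hP => hP.range hZ (by linarith [hZω ω h, sq_nonneg Z])
  have hlarge : ∀ ω η, Ω < ω → IsPeakParameter L Z ω η →
      M ≤ tailF (peakAmplitude η ω Z) (peakComplModulus η ω) := fun ω η h hP => by
    rw [(hrange ω η h hP).isPeakParameter_iff.1 hP, le_div_iff₀ hr0]
    exact (hMω ω h).trans
      (mul_le_mul_of_nonneg_left (hrange ω η h hP).sqrt_le_etaOne hL.le)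
  have hbox : ∀ ω η, Ω < ω → IsPeakParameter L Z ω η →
      (peakAmplitude η ω Z, peakComplModulus η ω) ∈ smallBox := fun ω η h hP =>
    (hrange ω η h hP).mem_smallBox (hZω ω h) (by linarith [hlarge ω η h hP])
  constructor
  · intro ω h
    obtain ⟨η, hη⟩ := exists_isPeakParameter hL hZ (hZω ω h)
      (by nlinarith [hMω ω h])
    refine ⟨η, hη, fun η' hη' => ?_⟩
    have hr := hrange ω η h hη
    have hr' := hrange ω η' h hη'
    have heq := eq_of_mem_smallBox (hbox ω η' h hη') (hbox ω η h hη)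
      (hr'.dnSlope_div_eq.trans hr.dnSlope_div_eq.symm)
      ((hη'.tailF_mul_eq hr').trans (hη.tailF_mul_eq hr).symm)
    have hp : peakComplModulus η' ω = peakComplModulus η ω := congrArg Prod.snd heq
    rw [hr'.eta_eq, hp, ← hr.eta_eq]
  · intro η₂ hη₂ ω h
    have hev : ∀ᶠ w in nhds ω, Ω < w := Ioi_mem_nhds h
    obtain ⟨d, hd, hd'⟩ := exists_pos_hasDerivAt_tailF_mul_tailE (L := L) (Z := Z)
      (c := fun w => (peakAmplitude (η₂ w) w Z, peakComplModulus (η₂ w) w))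
      (hrange ω _ h (hη₂ ω h)).omega_pos
      (hev.mono fun w hw => hbox w _ hw (hη₂ w hw))
      (hev.mono fun w hw => (hrange w _ hw (hη₂ w hw)).dnSlope_div_eq)
      (hev.mono fun w hw => (hη₂ w hw).tailF_mul_eq (hrange w _ hw (hη₂ w hw)))
      (hlarge ω _ h (hη₂ ω h))
    refine ⟨4 / L * d, by positivity, (hd'.const_mul (4 / L)).congr_of_eventuallyEq ?_⟩
    exact hev.mono fun w hw => (hη₂ w hw).normSq_eq (hrange w _ hw (hη₂ w hw)) hL
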